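/- **Setting.** Let $G=(V,E,s,t,c,e)$ be a finite network: $E\subseteq V\times V$ is symmetric, $s\ne t$, $c\colon E\to\mathbb N_0$ is the capacity, $e\colon V\setminus\{s,t\}\to\mathbb N_0$ is the excess, and $e(s)=\infty$, $e(t)=0$. A *preflow* is a map $f\colon E\to\mathbb Z$ with $f\le c$, $f(u,v)=-f(v,u)$ and $e(v)+\sum_u f(u,v)\ge 0$ for all $v$; its value is $|f|=\sum_u f(u,t)$. The residual network $G_f$ has capacities $c_f=c-f$, excesses $e_f(v)=e(v)+\sum_u f(u,v)$ for $v\neq t$, and $e_f(t)=0$. Write $u\to Y$ if there is a path (possibly of length $0$) of edges of positive capacity from $u$ to a vertex of $Y$. Fix a partition $R_1,\dots,R_K$ of $V\setminus\{s,t\}$ into regions. For a region $R$ let $B^R$ be the set of vertices $w\notin R\cup\{s,t\}$ with $(u,w)\in E$ for some $u\in R$. Let $\mathcal B=\bigcup_k B^{R_k}$ and $d^\infty=|\mathcal B|$. An edge is *inter-region* if its endpoints lie in two different regions. A labeling $d\colon V\to\{0,\dots,d^\infty\}$ is *valid* (for the region distance, which counts the inter-region edges on a path to $t$) in a network if $d(t)=0$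 and, for every edge $(u,v)$ of positive capacity, $d(u)\le d(v)+1$ if the edge is inter-region and $d(u)\le d(v)$ otherwise. A vertex $v$ is *active* if it has positive excess and $d(v)<d^\infty$. The *region network* $G^R$ has vertices $R\cup B^R\cup\{s,t\}$ and all edges of $E$ within $R\cup\{s,t\}$ and between $R$ and $B^R$; its capacities and its excesses on $R\cup\{s,t\}$ are those of $G$, except that the edges from $B^R$ to $R$ get capacity $0$. **ARD** on $(G^R,d)$: start with $f=0$ in $G^R$. For $j=0,1,\dots,d^\infty$, with $T_j=\{t\}\cup\{v\in B^R : d(v)<j\}$, do the following as long as possible: choose any path without repeated vertices, of edges of positive residual capacity in $G^R_f$, from a vertex $v_0\in R$ with $e_f(v_0)>0$ to a vertex of $T_j$, and augment $f$ along it by the minimum of $e_f(v_0)$ and the residual capacities of its edges. Then *region-relabel*: for every $u\in R$ set $d(u)=\min\{j : u\to T_j\}$ if $u\to T_{d^\infty}$ in $G^R_f$, and $d(u)=d^\infty$ otherwise; other labels are kept. **S-ARD**: saturate all edges $(s,v)$, $v\ne s$, replace $G$ by the residual network, and set $d(s)=d^\infty$ and $d=0$ elsewhere. While there is an active vertex,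 perform a *sweep*: for $k=1,\dots,K$ run ARD on the region network of $R_k$ in the current network, apply the resulting flow (pass to the residual network) and the resulting labels on $R_k$, and then, optionally, apply the global gap heuristic: for some $g>0$ such that no vertex of $\mathcal B$ has label $g$, set all labels larger than $g$ to $d^\infty$. **Theorem.** For every choice of augmenting paths and of the optional gap steps, S-ARD terminates (every execution is finite), after at most $2|\mathcal B|^2+1$ sweeps. On termination, the total flow $f$ is a preflow in the input network $G$, the labeling $d$ is valid in $G_f$, and no vertex is active; if $\mathcal B\neq\emptyset$, then $f$ is a maximum preflow in $G$. -/

import Mathlib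

open Relation

noncomputable section

/-- A network `(V, E, s, t, c, e)`. Residual and region networks are again of this form. The source is
regarded as having infinite excess, so the number `e s` is never used. -/
structure Network (V : Type*) where
  E : V → V → Prop
  s : V
  t : V
  c : V → V → ℤ
  e : V → ℤ

namespace Network

variable {V : Type*} (G : Network V)

/-- The standing assumptions on an input network: `s ≠ t`, symmetric edge set, capacities in `ℕ` (extended
by `0` outside `E`), excesses in `ℕ`, and the convention `e t = 0`. -/
structure IsProper : Prop where
  s_ne_t : G.s ≠ G.t
  symm : ∀ u v, G.E u v → G.E v u
  c_nonneg : ∀ u v, G.E u v → 0 ≤ G.c u v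
  c_off : ∀ u v, ¬ G.E u v → G.c u v = 0
  e_nonneg : ∀ v, v ≠ G.s → 0 ≤ G.e v
  e_t : G.e G.t = 0

/-- `f : E → ℤ` (extended by `0` outside `E`) is a preflow. The preflow constraint at `s` is void, since
the source has infinite excess. -/
structure IsPreflow [Fintype V] (f : V → V → ℤ) : Prop where
  off : ∀ u v, ¬ G.E u v → f u v = 0
  capacity : ∀ u v, G.E u v → f u v ≤ G.c u v
  antisymm : ∀ u v, f u v = - f v u
  preflow : ∀ v, v ≠ G.s → 0 ≤ G.e v + ∑ u, f u v

/-- The flow value `|f|`. -/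
def value [Fintype V] (f : V → V → ℤ) : ℤ := ∑ u, f u G.t

/-- `f` is a preflow of maximum value. -/
def IsMaxPreflow [Fintype V] (f : V → V → ℤ) : Prop :=
  G.IsPreflow f ∧ ∀ f', G.IsPreflow f' → G.value f' ≤ G.value f

open Classical in
/-- The residual network `G_f`; the excess of the sink stays `0`. -/
def residual [Fintype V] (f : V → V → ℤ) : Network V where
  E := G.E
  s := G.s
  t := G.t
  c := fun u v => G.c u v - f u v
  e := fun v => if v = G.t then 0 else G.e v + ∑ u, f u v

/-- `v` has positive excess (`e s = ∞`, `e t = 0`). -/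
def HasExcess (v : V) : Prop := v ≠ G.t ∧ (v = G.s ∨ 0 < G.e v)

/-- An edge of strictly positive capacity. -/
def PosEdge (u v : V) : Prop := G.E u v ∧ 0 < G.c u v

/-- `v → w`: there is a path, possibly of length `0`, of edges of positive capacity. -/
def Reach (v w : V) : Prop := ReflTransGen G.PosEdge v w

/-- `v → Y`. -/
def ReachSet (v : V) (Y : Set V) : Prop := ∃ y ∈ Y, G.Reach v y

/-- The boundary `B^R` of a region `R`. -/
def regionBoundary (R : Finset V) : Set V :=
  {w | w ∉ R ∧ w ≠ G.s ∧ w ≠ G.t ∧ ∃ u ∈ R, G.E u w}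

open Classical in
/-- The region network `G^R`. Its vertex set `R ∪ B^R ∪ {s, t}` is kept inside `V`: no edge is incident
to any other vertex. -/
def regionNetwork (R : Finset V) : Network V where
  E := fun u v => G.E u v ∧
    (((u ∈ R ∨ u = G.s ∨ u = G.t) ∧ (v ∈ R ∨ v = G.s ∨ v = G.t)) ∨
      (u ∈ R ∧ v ∈ G.regionBoundary R) ∨ (u ∈ G.regionBoundary R ∧ v ∈ R))
  s := G.s
  t := G.t
  c := fun u v =>
    if (G.E u v ∧ (((u ∈ R ∨ u = G.s ∨ u = G.t) ∧ (v ∈ R ∨ v = G.s ∨ v = G.t)) ∨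
      (u ∈ R ∧ v ∈ G.regionBoundary R))) then G.c u v else 0
  e := fun v => if v ∈ R ∨ v = G.s ∨ v = G.t then G.e v else 0

/-- `v₀ :: l` is a path without repeated vertices, of edges of positive capacity, from a vertex of `X`
with positive excess to a vertex of `Y`. -/
def IsAugPath (X Y : Set V) (v₀ : V) (l : List V) : Prop :=
  v₀ ∈ X ∧ G.HasExcess v₀ ∧ l.getLastD v₀ ∈ Y ∧ (v₀ :: l).Nodup ∧ (v₀ :: l).IsChain G.PosEdge

/-- The amount `min (e v₀, min_i c (v_{i-1}, v_i))` that is augmented along the path `v₀ :: l`. -/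
def bottleneck (v₀ : V) (l : List V) : ℤ :=
  ((v₀ :: l).zip l).foldr (fun a m => min (G.c a.1 a.2) m) (G.e v₀)

end Network

open Classical in
/-- The flow of `Δ` units along the path with vertex list `p`. -/
def pathFlow {V : Type*} (p : List V) (Δ : ℤ) (u v : V) : ℤ :=
  (if (u, v) ∈ p.zip p.tail then Δ else 0) - (if (v, u) ∈ p.zip p.tail then Δ else 0)

namespace Network

variable {V : Type*} [Fintype V] (G : Network V)

/-- One iteration of the loop of `Augment(X, Y)` in the network `G`: the flow `g` becomes `g'` by
augmenting along some path of the residual network `G_g`. -/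
def AugmentStep (X Y : Set V) (g g' : V → V → ℤ) : Prop :=
  ∃ v₀ l, (G.residual g).IsAugPath X Y v₀ l ∧
    g' = fun u v => g u v + pathFlow (v₀ :: l) ((G.residual g).bottleneck v₀ l) u v

/-- The regions are pairwise disjoint and cover exactly `V ∖ {s, t}`. -/
structure IsRegionPartition {K : ℕ} (R : Fin K → Finset V) : Prop where
  disjoint : ∀ i j, i ≠ j → Disjoint (R i) (R j)
  cover : ∀ v, (∃ k, v ∈ R k) ↔ v ≠ G.s ∧ v ≠ G.t

open Classical in
/-- The boundary `𝓑 = ⋃ₖ B^{R_k}`. -/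
def boundary {K : ℕ} (R : Fin K → Finset V) : Finset V :=
  {v | ∃ k, v ∈ G.regionBoundary (R k)}

/-- `d^∞ = |𝓑|`. -/
def dInf {K : ℕ} (R : Fin K → Finset V) : ℕ := (G.boundary R).card

/-- `u` and `v` lie in two different regions. -/
def InterRegion {K : ℕ} (R : Fin K → Finset V) (u v : V) : Prop :=
  ∃ i j, i ≠ j ∧ u ∈ R i ∧ v ∈ R j

/-- Validity of a labeling `d : V → {0, …, d^∞}` with respect to the region distance, in which exactly
the inter-region edges have length `1` and all other edges have length `0`. -/
structure IsValidLabeling {K : ℕ} (R : Fin K → Finset V) (d : V → ℕ) : Prop where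
  le_dInf : ∀ v, d v ≤ G.dInf R
  sink : d G.t = 0
  inter : ∀ u v, G.PosEdge u v → InterRegion R u v → d u ≤ d v + 1
  intra : ∀ u v, G.PosEdge u v → ¬ InterRegion R u v → d u ≤ d v

/-- `v` is active in `G` with respect to the labeling `d`. -/
def IsActive {K : ℕ} (R : Fin K → Finset V) (d : V → ℕ) (v : V) : Prop :=
  G.HasExcess v ∧ d v < G.dInf R

/-- The target set `T_j` of stage `j` of the discharge of the region `R`. -/
def target (R : Finset V) (d : V → ℕ) (j : ℕ) : Set V :=
  {G.t} ∪ {v | v ∈ G.regionBoundary R ∧ d v < j}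

end Network

namespace SARD

variable {V : Type*}

/-- The position of the algorithm in its program:
* `test`: at the test of the `while` loop;
* `forLoop k`: in a sweep, the regions of index below `k` have been processed;
* `stage k j g`: in `ARD` on the region network of `R_k`, stage `j`, with current flow `g`;
* `halted`: the algorithm has terminated. -/
inductive Control (V : Type*) (K : ℕ) where
  | test : Control V K
  | forLoop (k : ℕ) : Control V K
  | stage (k : Fin K) (j : ℕ) (g : V → V → ℤ) : Control V K
  | halted : Control V K

/-- A state of the algorithm. The current network is the residual network, with respect to `f`, of the
input network; `d` is the labeling; `sweeps` is the number of sweeps begun so far. -/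
structure State (V : Type*) (K : ℕ) where
  f : V → V → ℤ
  d : V → ℕ
  sweeps : ℕ
  control : Control V K

variable [Fintype V] (G : Network V) {K : ℕ} (R : Fin K → Finset V)

open Classical in
/-- The preflow saturating all edges from `s` to other vertices. -/
def initFlow (u v : V) : ℤ :=
  if u = v then 0 else if u = G.s then G.c u v else if v = G.s then - G.c v u else 0

open Classical in
/-- The state after the initialization: the edges out of `s` are saturated, `d s = d^∞`, and `d = 0`
elsewhere. -/
def initState : State V K where
  f := initFlow G
  d := fun v => if v = G.s then G.dInf R else 0
  sweeps := 0
  control := .test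

open Classical in
/-- Region-relabel at the end of `ARD`: `N` is the region network, `T j` are the target sets, `D = d^∞`;
labels outside the region `A` are kept. -/
def regionRelabel (N : Network V) (A : Finset V) (T : ℕ → Set V) (D : ℕ) (d : V → ℕ) (u : V) : ℕ :=
  if u ∈ A then
    if N.ReachSet u (T D) then sInf {j | N.ReachSet u (T j)} else D
  else d u

open Classical in
/-- The global gap heuristic, turning `d` into `d'`: if no boundary vertex has the label `g > 0`, then all
labels above `g` are raised to `d^∞`. -/
def GapStep (d d' : V → ℕ) : Prop :=
  ∃ g, 0 < g ∧ (∀ v ∈ G.boundary R, d v ≠ g) ∧ d' = fun u => if g < d u then G.dInf R else d u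

/-- The region network of `R_k` built from the current network. -/
def currentRegion (f : V → V → ℤ) (k : Fin K) : Network V :=
  (G.residual f).regionNetwork (R k)

/-- The elementary steps of the sequential region discharge algorithm with discharge operation `ARD`. The
choice of augmenting paths, and whether the gap heuristic is applied, are arbitrary. -/
inductive Step : State V K → State V K → Prop
  /-- No active vertices: the algorithm terminates. -/
  | halt (f d n) (h : ∀ v, ¬ (G.residual f).IsActive R d v) :
      Step ⟨f, d, n, .test⟩ ⟨f, d, n, .halted⟩
  /-- There is an active vertex: a new sweep begins. -/
  | sweep (f d n) (v : V) (h : (G.residual f).IsActive R d v) :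
      Step ⟨f, d, n, .test⟩ ⟨f, d, n + 1, .forLoop 0⟩
  /-- All regions have been processed: the sweep ends. -/
  | sweepEnd (f d n) :
      Step ⟨f, d, n, .forLoop K⟩ ⟨f, d, n, .test⟩
  /-- `ARD` is called on region `R_k`; it starts with stage `0` and zero flow. -/
  | call (f d n) (k : Fin K) :
      Step ⟨f, d, n, .forLoop k⟩ ⟨f, d, n, .stage k 0 0⟩
  /-- One augmentation in stage `j`. -/
  | augment (f d n) (k : Fin K) (j : ℕ) (g g' : V → V → ℤ)
      (h : (currentRegion G R f k).AugmentStep (R k) (G.target (R k) d j) g g') :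
      Step ⟨f, d, n, .stage k j g⟩ ⟨f, d, n, .stage k j g'⟩
  /-- No augmenting path is left in stage `j < d^∞`: the next stage begins. -/
  | nextStage (f d n) (k : Fin K) (j : ℕ) (g : V → V → ℤ) (hj : j < G.dInf R)
      (h : ∀ g', ¬ (currentRegion G R f k).AugmentStep (R k) (G.target (R k) d j) g g') :
      Step ⟨f, d, n, .stage k j g⟩ ⟨f, d, n, .stage k (j + 1) g⟩
  /-- No augmenting path is left in stage `d^∞`: region-relabel is run, the flow and the labels are
  applied to the network, the gap heuristic is optionally applied, and the next region is taken. -/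
  | finish (f d n) (k : Fin K) (g : V → V → ℤ) (d' d'' : V → ℕ)
      (h : ∀ g', ¬ (currentRegion G R f k).AugmentStep (R k) (G.target (R k) d (G.dInf R)) g g')
      (hd' : d' = regionRelabel ((currentRegion G R f k).residual g) (R k)
        (G.target (R k) d) (G.dInf R) d)
      (hd'' : d'' = d' ∨ GapStep G R d' d'') :
      Step ⟨f, d, n, .stage k (G.dInf R) g⟩
        ⟨fun u v => f u v + g u v, d'', n, .forLoop (k + 1)⟩

/-- `σ` occurs in some execution of the algorithm. -/
def Reachable (σ : State V K) : Prop := ReflTransGen (Step G R) (initState G R) σ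

end SARD

end

/-!
A discharge sends the excess of a region to targets of increasing label. Augmenting to `T j` opens
no path to an earlier target for the excess which has been cut off from it, so at the end of a
discharge the active vertices of the region are gone, the new labels are the exact distances to the
targets, and labels have only increased. Flow leaving the region for a boundary vertex `v` comes
from an active vertex `x` which reached no target below `v`; hence the new label of `x` exceeds
that of `v`.

Consequently a vertex becomes active only together with a strict increase of the label of a
boundary vertex (after the first sweep all active vertices lie on the boundary). Inductively, if
`v` is still active after `n` sweeps, then `d v + n` is at most the sum of the boundary labels plus
`d^∞`, which gives `n ≤ |𝓑| * d^∞ + d^∞ ≤ 2 |𝓑|²`. Within a sweep, each augmentation decreases the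
integral excess of the region.

Along a path to the sink a valid label drops by at most `1`, and only at an edge between two
boundary vertices. A vertex of label `d^∞ = |𝓑| > 0` would therefore need `|𝓑| + 1` boundary
vertices on its paths to the sink. So at the end no excess reaches the sink, and the vertices which
do reach it form a saturated cut.
-/

section Sums

theorem add_sum_le_add_sum_of_le {ι M : Type*} [AddCommMonoid M] [PartialOrder M]
    [IsOrderedAddMonoid M] {s : Finset ι} {f g : ι → M} {i : ι} (hi : i ∈ s)
    (hfg : ∀ j ∈ s, f j ≤ g j) : g i + ∑ j ∈ s, f j ≤ f i + ∑ j ∈ s, g j := by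
  classical
  rw [← Finset.add_sum_erase s f hi, ← Finset.add_sum_erase s g hi, add_left_comm]
  exact add_le_add_right (add_le_add_right
    (Finset.sum_le_sum fun j hj => hfg j (Finset.mem_of_mem_erase hj)) _) _

theorem sum_sum_eq_zero_of_antisymm {ι M : Type*} [AddCommGroup M] [IsAddTorsionFree M]
    {f : ι → ι → M} (hf : ∀ i j, f i j = -f j i) (s : Finset ι) :
    ∑ i ∈ s, ∑ j ∈ s, f j i = 0 := by
  refine self_eq_neg.1 ?_
  rw [← Finset.sum_neg_distrib, Finset.sum_comm]
  refine Finset.sum_congr rfl fun i _ => ?_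
  rw [← Finset.sum_neg_distrib]
  exact Finset.sum_congr rfl fun j _ => hf _ _

end Sums

section Paths

variable {V : Type*} {r : V → V → Prop}

theorem reflTransGen_of_mem_of_isChain {a x : V} {l : List V} (h : (a :: l).IsChain r)
    (hx : x ∈ a :: l) : ReflTransGen r a x ∧ ReflTransGen r x (l.getLastD a) := by
  induction l generalizing a x with
  | nil =>
    obtain rfl := List.mem_singleton.1 hx
    exact ⟨.refl, .refl⟩
  | cons b l ih =>
    rw [List.isChain_cons_cons] at h
    rw [List.getLastD_cons]
    rcases List.mem_cons.1 hx with rfl | hx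
    · exact ⟨.refl, .head h.1 (ih h.2 List.mem_cons_self).2⟩
    · exact ⟨.head h.1 (ih h.2 hx).1, (ih h.2 hx).2⟩

theorem rel_of_mem_zip_of_isChain {a u v : V} {l : List V} (h : (a :: l).IsChain r)
    (huv : (u, v) ∈ (a :: l).zip l) : r u v := by
  induction l generalizing a with
  | nil => simp at huv
  | cons b l ih =>
    rw [List.isChain_cons_cons] at h
    rw [List.zip_cons_cons, List.mem_cons] at huv
    rcases huv with huv | huv
    · cases huv
      exact h.1
    · exact ih h.2 huv

theorem getLastD_append_cons (l₁ l₂ : List V) (a b : V) :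
    (l₁ ++ a :: l₂).getLastD b = l₂.getLastD a := by
  simp [List.getLast?_cons]

theorem exists_nodup_isChain_of_reflTransGen {a b : V} (h : ReflTransGen r a b) :
    ∃ l : List V, (a :: l).Nodup ∧ (a :: l).IsChain r ∧ l.getLastD a = b := by
  induction h using ReflTransGen.head_induction_on with
  | refl => exact ⟨[], List.nodup_singleton b, List.isChain_singleton b, rfl⟩
  | @head a c hac _ ih =>
    obtain ⟨l, hnodup, hchain, hlast⟩ := ih
    by_cases ha : a ∈ c :: l
    · obtain ⟨l₁, l₂, hsplit⟩ := List.append_of_mem ha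
      have hsuffix : a :: l₂ <:+ c :: l := ⟨l₁, hsplit.symm⟩
      refine ⟨l₂, hnodup.sublist hsuffix.sublist, hchain.suffix hsuffix, ?_⟩
      rw [← getLastD_append_cons l₁ l₂ a c, ← hsplit, List.getLastD_cons, hlast]
    · exact ⟨c :: l, List.nodup_cons.2 ⟨ha, hnodup⟩, List.isChain_cons_cons.2 ⟨hac, hchain⟩,
        by rw [List.getLastD_cons, hlast]⟩

theorem pathFlow_antisymm (p : List V) (Δ : ℤ) (u v : V) :
    pathFlow p Δ u v = -pathFlow p Δ v u :=
  (neg_sub _ _).symm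

theorem pathFlow_le {p : List V} {Δ : ℤ} (hΔ : 0 ≤ Δ) (u v : V) : pathFlow p Δ u v ≤ Δ := by
  unfold pathFlow
  split_ifs <;> linarith

theorem pathFlow_nonpos {p : List V} {Δ : ℤ} (hΔ : 0 ≤ Δ) {u v : V} (h : (u, v) ∉ p.zip p.tail) :
    pathFlow p Δ u v ≤ 0 := by
  unfold pathFlow
  rw [if_neg h]
  split_ifs <;> linarith

open Classical in
theorem pathFlow_cons_cons {a b : V} {l : List V} (Δ : ℤ) (h : (a :: b :: l).Nodup) (u v : V) :
    pathFlow (a :: b :: l) Δ u v =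
      (if u = a ∧ v = b then Δ else 0) - (if v = a ∧ u = b then Δ else 0) +
        pathFlow (b :: l) Δ u v := by
  have ha : a ∉ b :: l := (List.nodup_cons.1 h).1
  have hab : a ≠ b := fun hab => ha (hab ▸ List.mem_cons_self)
  have hleft (y : V) : (a, y) ∉ (b :: l).zip l := fun hy => ha (List.of_mem_zip hy).1
  have hright (y : V) : (y, a) ∉ (b :: l).zip l := fun hy =>
    ha (List.mem_cons_of_mem _ (List.of_mem_zip hy).2)
  simp only [pathFlow, List.tail_cons, List.zip_cons_cons, List.mem_cons, Prod.mk.injEq]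
  by_cases hu : u = a
  · simp [hu, hab, hleft, hright]
  · by_cases hv : v = a
    · simp [hv, hab, hleft, hright]
    · simp only [hu, hv, false_and, if_false, false_or, sub_zero, zero_add]
      congr

open Classical in
theorem sum_pathFlow [Fintype V] {a : V} {l : List V} (h : (a :: l).Nodup) (Δ : ℤ) (v : V) :
    ∑ u, pathFlow (a :: l) Δ u v =
      (if v = l.getLastD a then Δ else 0) - (if v = a then Δ else 0) := by
  induction l generalizing a with
  | nil => simp [pathFlow]
  | cons b l ih =>
    simp only [pathFlow_cons_cons Δ h, Finset.sum_add_distrib, Finset.sum_sub_distrib,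
      ih (List.nodup_cons.1 h).2, List.getLastD_cons, ite_and, Finset.sum_ite_eq',
      Finset.sum_ite_irrel, Finset.sum_const_zero, Finset.mem_univ, if_true]
    ring

end Paths

namespace Network

section Reach

variable {V : Type*} {G : Network V} {u v : V} {Y Z : Set V}

theorem ReachSet.of_mem (h : v ∈ Y) : G.ReachSet v Y :=
  ⟨v, h, .refl⟩

theorem ReachSet.mono (h : G.ReachSet v Y) (hYZ : Y ⊆ Z) : G.ReachSet v Z :=
  h.imp fun _ hy => ⟨hYZ hy.1, hy.2⟩

theorem Reach.trans_reachSet (huv : G.Reach u v) (h : G.ReachSet v Y) : G.ReachSet u Y :=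
  h.imp fun _ hy => ⟨hy.1, huv.trans hy.2⟩

theorem PosEdge.trans_reachSet (huv : G.PosEdge u v) (h : G.ReachSet v Y) : G.ReachSet u Y :=
  Reach.trans_reachSet (.single huv) h

theorem ReachSet.induction {p : V → Prop} (hY : ∀ y ∈ Y, p y)
    (hp : ∀ u v, G.PosEdge u v → G.ReachSet v Y → p v → p u) (h : G.ReachSet u Y) : p u := by
  obtain ⟨y, hy, h⟩ := h
  induction h using ReflTransGen.head_induction_on with
  | refl => exact hY y hy
  | head huv hv ih => exact hp _ _ huv ⟨y, hy, hv⟩ ih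

end Reach

section Proper

variable {V : Type*} {G : Network V}

theorem IsProper.capacity_nonneg (hG : G.IsProper) (u v : V) : 0 ≤ G.c u v := by
  by_cases hE : G.E u v
  · exact hG.c_nonneg u v hE
  · exact (hG.c_off u v hE).ge

theorem IsProper.posEdge_of_pos (hG : G.IsProper) {u v : V} (h : 0 < G.c u v) : G.PosEdge u v :=
  ⟨not_not.1 fun hE => h.ne' (hG.c_off u v hE), h⟩

end Proper

section Residual

variable {V : Type*} [Fintype V] {G : Network V} {f g : V → V → ℤ}

theorem residual_e_of_ne {v : V} (hv : v ≠ G.t) (f : V → V → ℤ) :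
    (G.residual f).e v = G.e v + ∑ u, f u v :=
  if_neg hv

theorem IsProper.residual (hG : G.IsProper) (hf : G.IsPreflow f) : (G.residual f).IsProper where
  s_ne_t := hG.s_ne_t
  symm := hG.symm
  c_nonneg u v h := sub_nonneg.2 (hf.capacity u v h)
  c_off u v h := sub_eq_zero.2 ((hG.c_off u v h).trans (hf.off u v h).symm)
  e_nonneg v hv := by
    by_cases hvt : v = G.t
    · exact (if_pos hvt).ge
    · exact (hf.preflow v hv).trans_eq (residual_e_of_ne hvt f).symm
  e_t := if_pos rfl

theorem IsPreflow.le_capacity (hf : G.IsPreflow f) (hG : G.IsProper) (u v : V) :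
    f u v ≤ G.c u v :=
  sub_nonneg.1 ((hG.residual hf).capacity_nonneg u v)

theorem IsProper.isPreflow_zero (hG : G.IsProper) : G.IsPreflow 0 where
  off _ _ _ := rfl
  capacity := hG.c_nonneg
  antisymm _ _ := rfl
  preflow v hv := by simpa using hG.e_nonneg v hv

theorem residual_zero (hG : G.IsProper) : G.residual 0 = G := by
  have he : (G.residual 0).e = G.e := by
    funext v
    by_cases hv : v = G.t
    · exact (if_pos hv).trans (hv ▸ hG.e_t).symm
    · simp [residual_e_of_ne hv]
  have hc : (G.residual 0).c = G.c := funext₂ fun u v => sub_zero (G.c u v)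
  exact congrArg₂ (Network.mk G.E G.s G.t) hc he

theorem IsPreflow.add (hG : G.IsProper) (hf : G.IsPreflow f) (hg : (G.residual f).IsPreflow g) :
    G.IsPreflow (fun u v => f u v + g u v) where
  off u v h := by rw [hf.off u v h, hg.off u v h, add_zero]
  capacity u v h := le_sub_iff_add_le'.1 (hg.capacity u v h)
  antisymm u v := by rw [hf.antisymm, hg.antisymm, neg_add]
  preflow v hv := by
    have hgv := hg.preflow v hv
    rw [Finset.sum_add_distrib]
    by_cases hvt : v = G.t
    · have hfv := hf.preflow v hv
      rw [hvt, hG.e_t] at hfv ⊢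
      rw [hvt, show (G.residual f).e G.t = 0 from (hG.residual hf).e_t] at hgv
      linarith
    · rw [residual_e_of_ne hvt] at hgv
      linarith

theorem residual_residual (G : Network V) (f g : V → V → ℤ) :
    (G.residual f).residual g = G.residual (fun u v => f u v + g u v) := by
  simp only [residual, Network.mk.injEq, true_and]
  refine ⟨funext₂ fun u v => sub_sub _ _ _, funext fun v => ?_⟩
  by_cases hv : v = G.t
  · simp only [hv, if_true]
  · simp only [hv, if_false, Finset.sum_add_distrib, add_assoc]

theorem IsPreflow.posEdge_or (hg : G.IsPreflow g) {u v : V} (h : (G.residual g).PosEdge u v) :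
    G.PosEdge u v ∨ 0 < g v u := by
  refine or_iff_not_imp_right.2 fun hvu => ⟨h.1, ?_⟩
  have hpos : 0 < G.c u v - g u v := h.2
  have := hg.antisymm u v
  linarith

theorem IsPreflow.posEdge_residual_of_pos (hG : G.IsProper) (hg : G.IsPreflow g) {u v : V}
    (h : 0 < g v u) : (G.residual g).PosEdge u v := by
  refine (hG.residual hg).posEdge_of_pos (show 0 < G.c u v - g u v from ?_)
  have := hg.antisymm u v
  have := hG.capacity_nonneg u v
  linarith

theorem HasExcess.of_residual_or {v : V} (h : (G.residual g).HasExcess v) :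
    G.HasExcess v ∨ 0 < ∑ u, g u v := by
  rcases h with ⟨hvt, hvs | hpos⟩
  · exact .inl ⟨hvt, .inl hvs⟩
  · have hvt : v ≠ G.t := hvt
    rw [residual_e_of_ne hvt] at hpos
    refine or_iff_not_imp_right.2 fun hinflow => ⟨hvt, .inr ?_⟩
    linarith

end Residual

section Augmentation

variable {V : Type*} {G : Network V} {X Y Z : Set V} {v₀ : V} {l : List V}

theorem le_bottleneck_iff {a : ℤ} :
    a ≤ G.bottleneck v₀ l ↔ a ≤ G.e v₀ ∧ ∀ p ∈ (v₀ :: l).zip l, a ≤ G.c p.1 p.2 := by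
  unfold bottleneck
  induction (v₀ :: l).zip l with
  | nil => simp
  | cons p m ih =>
    rw [List.foldr_cons, le_min_iff, ih, List.forall_mem_cons]
    exact and_left_comm

namespace IsAugPath

theorem bottleneck_pos (h : G.IsAugPath X Y v₀ l) (hs : G.s ∉ X) : 0 < G.bottleneck v₀ l := by
  obtain ⟨hX, hexcess, -, -, hchain⟩ := h
  refine le_bottleneck_iff.2 ⟨hexcess.2.resolve_left fun hv₀ => hs (hv₀ ▸ hX), fun p hp => ?_⟩
  exact (rel_of_mem_zip_of_isChain hchain hp).2

variable [Fintype V]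

theorem isPreflow (h : G.IsAugPath X Y v₀ l) (hs : G.s ∉ X) (hG : G.IsProper) :
    G.IsPreflow (pathFlow (v₀ :: l) (G.bottleneck v₀ l)) where
  off u v hE := by
    have hzip {a b : V} (hab : (a, b) ∈ (v₀ :: l).zip l) : G.E a b :=
      (rel_of_mem_zip_of_isChain h.2.2.2.2 hab).1
    have huv : (u, v) ∉ (v₀ :: l).zip l := fun huv => hE (hzip huv)
    have hvu : (v, u) ∉ (v₀ :: l).zip l := fun hvu => hE (hG.symm _ _ (hzip hvu))
    simp [pathFlow, huv, hvu]
  capacity u v _ := by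
    have hΔ := (h.bottleneck_pos hs).le
    by_cases huv : (u, v) ∈ (v₀ :: l).zip l
    · exact (pathFlow_le hΔ u v).trans ((le_bottleneck_iff.1 le_rfl).2 _ huv)
    · exact (pathFlow_nonpos hΔ huv).trans (hG.capacity_nonneg u v)
  antisymm := pathFlow_antisymm _ _
  preflow v hv := by
    have hΔ := (h.bottleneck_pos hs).le
    have hΔe : G.bottleneck v₀ l ≤ G.e v₀ := (le_bottleneck_iff.1 le_rfl).1
    have he := hG.e_nonneg v hv
    rw [sum_pathFlow h.2.2.2.1]
    by_cases hv₀ : v = v₀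
    · subst hv₀
      rw [if_pos rfl]
      split_ifs <;> linarith
    · rw [if_neg hv₀]
      split_ifs <;> linarith

theorem reachSet_of_residual (h : G.IsAugPath X Y v₀ l) (hs : G.s ∉ X) (hG : G.IsProper)
    (hZ : Y ⊆ Z ∨ ¬ G.ReachSet v₀ Z) {u : V}
    (hu : (G.residual (pathFlow (v₀ :: l) (G.bottleneck v₀ l))).ReachSet u Z) :
    G.ReachSet u Z := by
  refine hu.induction (p := (G.ReachSet · Z)) (fun y hy => .of_mem hy) fun a b hab _ hb => ?_
  rcases (h.isPreflow hs hG).posEdge_or hab with hab | hba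
  · exact hab.trans_reachSet hb
  have hzip : (b, a) ∈ (v₀ :: l).zip l := by
    by_contra hzip
    exact hba.not_ge (pathFlow_nonpos (h.bottleneck_pos hs).le hzip)
  have hchain := h.2.2.2.2
  rcases hZ with hYZ | hv₀
  · have ha : a ∈ v₀ :: l := List.mem_cons_of_mem _ (List.of_mem_zip hzip).2
    exact ⟨_, hYZ h.2.2.1, (reflTransGen_of_mem_of_isChain hchain ha).2⟩
  · have hv₀b := (reflTransGen_of_mem_of_isChain hchain (List.of_mem_zip hzip).1).1
    exact absurd (Reach.trans_reachSet hv₀b hb) hv₀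

theorem residual_e_le (h : G.IsAugPath X Y v₀ l) (hs : G.s ∉ X) (hG : G.IsProper) {v : V}
    (hv : v ∉ Y) : (G.residual (pathFlow (v₀ :: l) (G.bottleneck v₀ l))).e v ≤ G.e v := by
  have hΔ := h.bottleneck_pos hs
  by_cases hvt : v = G.t
  · exact ((if_pos hvt).trans (hvt ▸ hG.e_t).symm).le
  · have hlast : v ≠ l.getLastD v₀ := fun hlast => hv (hlast ▸ h.2.2.1)
    rw [residual_e_of_ne hvt, sum_pathFlow h.2.2.2.1, if_neg hlast]
    split_ifs <;> linarith

theorem residual_e_lt (h : G.IsAugPath X Y v₀ l) (hs : G.s ∉ X) (hv₀ : v₀ ∉ Y) :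
    (G.residual (pathFlow (v₀ :: l) (G.bottleneck v₀ l))).e v₀ < G.e v₀ := by
  have hΔ := h.bottleneck_pos hs
  have hlast : v₀ ≠ l.getLastD v₀ := fun hlast => hv₀ (hlast ▸ h.2.2.1)
  rw [residual_e_of_ne h.2.1.1, sum_pathFlow h.2.2.2.1, if_neg hlast, if_pos rfl]
  linarith

end IsAugPath

end Augmentation

section AugmentStep

variable {V : Type*} [Fintype V] {G : Network V} {X Y : Set V} {g g' : V → V → ℤ}

theorem not_reachSet_of_no_augmentStep (h : ∀ g', ¬ G.AugmentStep X Y g g') {v : V} (hv : v ∈ X)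
    (he : (G.residual g).HasExcess v) : ¬ (G.residual g).ReachSet v Y := by
  rintro ⟨y, hy, hvy⟩
  obtain ⟨l, hnodup, hchain, rfl⟩ := exists_nodup_isChain_of_reflTransGen hvy
  exact h _ ⟨v, l, ⟨hv, he, hy, hnodup, hchain⟩, rfl⟩

theorem AugmentStep.sum_excess_lt {A : Finset V} (h : G.AugmentStep A Y g g') (hG : G.IsProper)
    (hg : G.IsPreflow g) (hs : G.s ∉ A) (hAY : ∀ v ∈ A, v ∉ Y) :
    ∑ v ∈ A, (G.residual g').e v < ∑ v ∈ A, (G.residual g).e v := by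
  obtain ⟨v₀, l, hpath, rfl⟩ := h
  rw [← residual_residual]
  exact Finset.sum_lt_sum (fun v hv => hpath.residual_e_le hs (hG.residual hg) (hAY v hv))
    ⟨v₀, hpath.1, hpath.residual_e_lt hs (hAY v₀ hpath.1)⟩

end AugmentStep

/-- What holds of the flow `g` during stage `j` of an augmentation from `X`, to growing targets
`T 0 ⊆ T 1 ⊆ …`, in the network `G`: in particular excess of `X` which misses an earlier target
misses it for good, and whoever receives flow outside `X` got some of it from a vertex with excess
which was able to reach no smaller target. -/
structure IsStageFlow {V : Type*} [Fintype V] (G : Network V) (X : Set V) (T : ℕ → Set V) (j : ℕ)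
    (g : V → V → ℤ) : Prop where
  isPreflow : G.IsPreflow g
  hasExcess : ∀ v ∈ X, (G.residual g).HasExcess v → G.HasExcess v
  not_reachSet : ∀ v ∈ X, (G.residual g).HasExcess v → ∀ i < j, ¬ (G.residual g).ReachSet v (T i)
  reachSet_of_residual : ∀ i u, (G.residual g).ReachSet u (T i) → G.ReachSet u (T i)
  exists_sender : ∀ w ∉ X, 0 < ∑ u, g u w → w ∈ T j ∧ ∃ x ∈ X, G.HasExcess x ∧
    G.ReachSet x (T j) ∧ ∀ i, w ∉ T i → ¬ (G.residual g).ReachSet x (T i)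

namespace IsStageFlow

variable {V : Type*} [Fintype V] {G : Network V} {X : Set V} {T : ℕ → Set V} {j : ℕ}
  {g g' : V → V → ℤ}

theorem zero (hG : G.IsProper) : G.IsStageFlow X T 0 0 where
  isPreflow := hG.isPreflow_zero
  hasExcess _ _ h := residual_zero hG ▸ h
  not_reachSet _ _ _ _ hi := absurd hi (Nat.not_lt_zero _)
  reachSet_of_residual _ _ h := residual_zero hG ▸ h
  exists_sender w _ h := absurd h (by simp)

theorem succ (h : G.IsStageFlow X T j g) (hT : Monotone T)
    (hmax : ∀ g', ¬ G.AugmentStep X (T j) g g') : G.IsStageFlow X T (j + 1) g where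
  isPreflow := h.isPreflow
  hasExcess := h.hasExcess
  not_reachSet v hv he i hi := by
    rcases Nat.lt_succ_iff_lt_or_eq.1 hi with hi | rfl
    · exact h.not_reachSet v hv he i hi
    · exact not_reachSet_of_no_augmentStep hmax hv he
  reachSet_of_residual := h.reachSet_of_residual
  exists_sender w hw hpos := by
    obtain ⟨hwT, x, hx, he, hreach, hnot⟩ := h.exists_sender w hw hpos
    exact ⟨hT j.le_succ hwT, x, hx, he, hreach.mono (hT j.le_succ), hnot⟩

theorem augment (h : G.IsStageFlow X T j g) (hG : G.IsProper) (hT : Monotone T) (hs : G.s ∉ X)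
    (hXT : ∀ v ∈ X, v ∉ T j) (hstep : G.AugmentStep X (T j) g g') : G.IsStageFlow X T j g' := by
  obtain ⟨v₀, l, hpath, rfl⟩ := hstep
  have hGg := hG.residual h.isPreflow
  have hexcess {v : V} (hv : v ∈ X) (he : ((G.residual g).residual (pathFlow (v₀ :: l)
      ((G.residual g).bottleneck v₀ l))).HasExcess v) : (G.residual g).HasExcess v :=
    ⟨he.1, he.2.imp_right fun hpos => hpos.trans_le (hpath.residual_e_le hs hGg (hXT v hv))⟩
  have hv₀ {i : ℕ} (hi : i < j) : ¬ (G.residual g).ReachSet v₀ (T i) :=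
    h.not_reachSet v₀ hpath.1 hpath.2.1 i hi
  have hreach {i : ℕ} {u : V} (hu : ((G.residual g).residual (pathFlow (v₀ :: l)
      ((G.residual g).bottleneck v₀ l))).ReachSet u (T i)) : (G.residual g).ReachSet u (T i) :=
    hpath.reachSet_of_residual hs hGg ((le_or_gt j i).imp (fun hi => hT hi) hv₀) hu
  constructor
  case isPreflow => exact h.isPreflow.add hG (hpath.isPreflow hs hGg)
  all_goals rw [← residual_residual]
  case hasExcess => exact fun v hv he => h.hasExcess v hv (hexcess hv he)
  case not_reachSet =>
    exact fun v hv he i hi hvT => h.not_reachSet v hv (hexcess hv he) i hi (hreach hvT)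
  case reachSet_of_residual => exact fun i u hu => h.reachSet_of_residual i u (hreach hu)
  case exists_sender =>
    intro w hw hpos
    by_cases hlast : w = l.getLastD v₀
    · have hwT : w ∈ T j := hlast ▸ hpath.2.2.1
      have hv₀T : (G.residual g).ReachSet v₀ (T j) := ⟨w, hwT, hlast ▸
        (reflTransGen_of_mem_of_isChain hpath.2.2.2.2 List.mem_cons_self).2⟩
      refine ⟨hwT, v₀, hpath.1, h.hasExcess v₀ hpath.1 hpath.2.1,
        h.reachSet_of_residual j v₀ hv₀T, fun i hwi hv₀i => ?_⟩
      exact hv₀ (lt_of_not_ge fun hji => hwi (hT hji hwT)) (hreach hv₀i)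
    · have hwv₀ : w ≠ v₀ := fun hwv₀ => hw (hwv₀ ▸ hpath.1)
      rw [Finset.sum_add_distrib, sum_pathFlow hpath.2.2.2.1, if_neg hlast, if_neg hwv₀, sub_zero,
        add_zero] at hpos
      obtain ⟨hwT, x, hx, he, hxT, hnot⟩ := h.exists_sender w hw hpos
      exact ⟨hwT, x, hx, he, hxT, fun i hwi hxi => hnot i hwi (hreach hxi)⟩

end IsStageFlow

end Network

namespace Network

section RegionNetwork

variable {V : Type*} {N : Network V} {A : Finset V} {d : V → ℕ} {u v : V}

theorem regionNetwork_E_iff_of_mem (hu : u ∈ A) : (N.regionNetwork A).E u v ↔ N.E u v := by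
  refine ⟨And.left, fun h => ⟨h, ?_⟩⟩
  by_cases hv : v ∈ A ∨ v = N.s ∨ v = N.t
  · exact .inl ⟨.inl hu, hv⟩
  · push Not at hv
    exact .inr (.inl ⟨hu, hv.1, hv.2.1, hv.2.2, u, hu, h⟩)

theorem regionNetwork_c_of_mem (hu : u ∈ A) (h : N.E u v) : (N.regionNetwork A).c u v = N.c u v :=
  if_pos ⟨h, ((regionNetwork_E_iff_of_mem hu).2 h).2.imp_right fun h' =>
    h'.resolve_right fun hBA => hBA.1.1 hu⟩

open Classical in
theorem regionNetwork_c_eq_zero_or (u v : V) :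
    (N.regionNetwork A).c u v = 0 ∨ (N.regionNetwork A).c u v = N.c u v :=
  (ite_eq_or_eq _ _ _).symm

open Classical in
theorem regionNetwork_e_eq_zero_or (v : V) :
    (N.regionNetwork A).e v = 0 ∨ (N.regionNetwork A).e v = N.e v :=
  (ite_eq_or_eq _ _ _).symm

theorem regionNetwork_hasExcess_iff (hv : v ∈ A) :
    (N.regionNetwork A).HasExcess v ↔ N.HasExcess v := by
  have he : (N.regionNetwork A).e v = N.e v := if_pos (.inl hv)
  simp only [HasExcess, he]
  rfl

theorem regionNetwork_posEdge_iff_of_mem (hu : u ∈ A) :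
    (N.regionNetwork A).PosEdge u v ↔ N.PosEdge u v := by
  rw [PosEdge, PosEdge, regionNetwork_E_iff_of_mem hu]
  exact and_congr_right fun h => by rw [regionNetwork_c_of_mem hu h]

theorem PosEdge.of_regionNetwork (h : (N.regionNetwork A).PosEdge u v) : N.PosEdge u v := by
  refine ⟨h.1.1, ?_⟩
  rcases regionNetwork_c_eq_zero_or (N := N) (A := A) u v with hc | hc
  · exact absurd h.2 hc.not_gt
  · exact hc ▸ h.2

theorem not_posEdge_regionNetwork_of_mem_boundary (hu : u ∈ N.regionBoundary A) :
    ¬ (N.regionNetwork A).PosEdge u v := by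
  intro h
  refine h.2.ne' (if_neg ?_)
  rintro ⟨-, ⟨huA | hus | hut, -⟩ | ⟨huA, -⟩⟩
  exacts [hu.1 huA, hu.2.1 hus, hu.2.2.1 hut, hu.1 huA]

theorem IsProper.regionNetwork (hN : N.IsProper) (A : Finset V) :
    (N.regionNetwork A).IsProper where
  s_ne_t := hN.s_ne_t
  symm u v h := ⟨hN.symm u v h.1, h.2.imp And.symm fun h' => h'.symm.imp And.symm And.symm⟩
  c_nonneg u v h := by
    rcases regionNetwork_c_eq_zero_or (N := N) (A := A) u v with hc | hc
    · exact hc.ge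
    · exact (hN.c_nonneg u v h.1).trans_eq hc.symm
  c_off u v h := if_neg fun h' => h ⟨h'.1, h'.2.imp_right .inl⟩
  e_nonneg v hv := by
    rcases regionNetwork_e_eq_zero_or (N := N) (A := A) v with he | he
    · exact he.ge
    · exact (hN.e_nonneg v hv).trans_eq he.symm
  e_t := (if_pos (.inr (.inr rfl))).trans hN.e_t

theorem monotone_target : Monotone (N.target A d) :=
  fun _ _ hij => Set.union_subset_union_right _ fun _ hv => ⟨hv.1, hv.2.trans_le hij⟩

theorem sink_mem_target (j : ℕ) : N.t ∈ N.target A d j :=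
  .inl rfl

theorem source_notMem_target (hN : N.IsProper) (j : ℕ) : N.s ∉ N.target A d j := by
  rintro (h | h)
  · exact hN.s_ne_t h
  · exact h.1.2.1 rfl

theorem notMem_target_self (hv : v ≠ N.t) : v ∉ N.target A d (d v) := by
  rintro (h | h)
  · exact hv h
  · exact lt_irrefl _ h.2

theorem mem_target_of_reachSet (hs : ∀ w, w ≠ N.s → ¬ N.PosEdge N.s w) {i : ℕ}
    (h : (N.regionNetwork A).ReachSet v (N.target A d i)) (hv : v ∉ A) : v ∈ N.target A d i := by
  revert hv
  refine h.induction (p := fun v => v ∉ A → v ∈ N.target A d i) (fun y hy _ => hy)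
    fun a b hab _ hb ha => ?_
  have haB : a ∉ N.regionBoundary A := fun haB => not_posEdge_regionNetwork_of_mem_boundary haB hab
  rcases hab.1.2 with ⟨haA | has | hat, -⟩ | ⟨haA, -⟩ | ⟨haB', -⟩
  · exact absurd haA ha
  · subst has
    have hbs : b = N.s := by
      by_contra hbs
      exact hs b hbs hab.of_regionNetwork
    exact hbs ▸ hb (hbs ▸ ha)
  · exact hat ▸ sink_mem_target i
  · exact absurd haA ha
  · exact absurd haB' haB

theorem ReachSet.induction_regionNetwork (hs : ∀ w, w ≠ N.s → ¬ N.PosEdge N.s w) {i : ℕ}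
    (hA : ∀ v ∈ A, v ∉ N.target A d i) {p : V → Prop}
    (hp : ∀ u ∈ A, ∀ v, N.PosEdge u v → (v ∈ A → p v) → (v ∉ A → v ∈ N.target A d i) → p u)
    (h : (N.regionNetwork A).ReachSet u (N.target A d i)) (hu : u ∈ A) : p u := by
  revert hu
  refine h.induction (p := fun u => u ∈ A → p u) (fun y hy hyA => absurd hy (hA y hyA))
    fun a b hab hb ihb ha => ?_
  exact hp a ha b hab.of_regionNetwork ihb (mem_target_of_reachSet hs hb)

variable [Fintype V] {g : V → V → ℤ}

theorem residual_regionNetwork_posEdge_iff_of_mem (hu : u ∈ A) :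
    ((N.regionNetwork A).residual g).PosEdge u v ↔ (N.residual g).PosEdge u v := by
  change (N.regionNetwork A).E u v ∧ 0 < (N.regionNetwork A).c u v - g u v ↔
    N.E u v ∧ 0 < N.c u v - g u v
  rw [regionNetwork_E_iff_of_mem hu]
  exact and_congr_right fun h => by rw [regionNetwork_c_of_mem hu h]

theorem residual_regionNetwork_hasExcess_iff (hv : v ∈ A) :
    ((N.regionNetwork A).residual g).HasExcess v ↔ (N.residual g).HasExcess v := by
  have he : (N.regionNetwork A).e v = N.e v := if_pos (.inl hv)
  simp only [HasExcess, residual, he]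
  rfl

theorem IsPreflow.of_regionNetwork (hN : N.IsProper) (hg : (N.regionNetwork A).IsPreflow g) :
    N.IsPreflow g where
  off u v h := hg.off u v fun h' => h h'.1
  capacity u v h := by
    by_cases hE : (N.regionNetwork A).E u v
    · refine (hg.capacity u v hE).trans ?_
      rcases regionNetwork_c_eq_zero_or (N := N) (A := A) u v with hc | hc
      · exact hc.trans_le (hN.c_nonneg u v h)
      · exact hc.le
    · exact (hg.off u v hE).trans_le (hN.c_nonneg u v h)
  antisymm := hg.antisymm
  preflow v hv := by
    refine (hg.preflow v hv).trans ?_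
    rcases regionNetwork_e_eq_zero_or (N := N) (A := A) v with he | he
    · exact add_le_add_left (he.trans_le (hN.e_nonneg v hv)) _
    · exact (congrArg (· + _) he).le

end RegionNetwork

section Partition

variable {V : Type*} {K : ℕ} {N : Network V} {R : Fin K → Finset V} {u v : V}

theorem InterRegion.symm (h : InterRegion R u v) : InterRegion R v u :=
  have ⟨i, j, hij, hi, hj⟩ := h
  ⟨j, i, hij.symm, hj, hi⟩

namespace IsRegionPartition

theorem ne_source (hR : N.IsRegionPartition R) {k : Fin K} (hv : v ∈ R k) : v ≠ N.s :=
  ((hR.cover v).1 ⟨k, hv⟩).1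

theorem ne_sink (hR : N.IsRegionPartition R) {k : Fin K} (hv : v ∈ R k) : v ≠ N.t :=
  ((hR.cover v).1 ⟨k, hv⟩).2

theorem source_notMem (hR : N.IsRegionPartition R) (k : Fin K) : N.s ∉ R k :=
  fun h => hR.ne_source h rfl

theorem eq_of_mem (hR : N.IsRegionPartition R) {i j : Fin K} (hi : v ∈ R i) (hj : v ∈ R j) :
    i = j := by
  by_contra hij
  exact Finset.disjoint_left.1 (hR.disjoint i j hij) hi hj

theorem not_interRegion (hR : N.IsRegionPartition R) {k : Fin K} (hu : u ∈ R k) (hv : v ∈ R k) :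
    ¬ InterRegion R u v := by
  rintro ⟨i, j, hij, hi, hj⟩
  exact hij ((hR.eq_of_mem hi hu).trans (hR.eq_of_mem hv hj))

theorem not_interRegion_sink (hR : N.IsRegionPartition R) : ¬ InterRegion R u N.t :=
  fun ⟨_, _, _, _, ht⟩ => hR.ne_sink ht rfl

theorem interRegion_of_mem_regionBoundary (hR : N.IsRegionPartition R) {k : Fin K} (hu : u ∈ R k)
    (hv : v ∈ N.regionBoundary (R k)) : InterRegion R u v := by
  obtain ⟨i, hi⟩ := (hR.cover v).2 ⟨hv.2.1, hv.2.2.1⟩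
  exact ⟨k, i, fun hki => hv.1 (hki ▸ hi), hu, hi⟩

theorem mem_regionBoundary_of_interRegion (hR : N.IsRegionPartition R) (h : InterRegion R u v)
    {k : Fin K} (hu : u ∈ R k) (hE : N.E u v) : v ∈ N.regionBoundary (R k) := by
  obtain ⟨i, j, hij, hi, hj⟩ := h
  obtain rfl := hR.eq_of_mem hi hu
  exact ⟨fun h => hij (hR.eq_of_mem h hj), hR.ne_source hj, hR.ne_sink hj, u, hu, hE⟩

theorem notMem_target (hR : N.IsRegionPartition R) {k : Fin K} (hv : v ∈ R k) (d : V → ℕ) (j : ℕ) :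
    v ∉ N.target (R k) d j := by
  rintro (h | h)
  · exact hR.ne_sink hv h
  · exact h.1.1 hv

end IsRegionPartition

variable [Fintype V]

theorem mem_boundary : v ∈ N.boundary R ↔ ∃ k, v ∈ N.regionBoundary (R k) := by
  simp [boundary]

theorem InterRegion.mem_boundary (h : InterRegion R u v) (hR : N.IsRegionPartition R)
    (hE : N.E u v) : v ∈ N.boundary R :=
  have ⟨i, _, _, hi, _⟩ := h
  Network.mem_boundary.2 ⟨i, hR.mem_regionBoundary_of_interRegion h hi hE⟩

end Partition

/-- What the algorithm maintains between two discharges: besides validity, that the source is out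
of play, and that within a region an excess with a label of `d^∞` cannot reach its targets. The
latter is void when there is no boundary, where no vertex is active from the start. -/
structure IsAdmissible {V : Type*} [Fintype V] {K : ℕ} (N : Network V) (R : Fin K → Finset V)
    (d : V → ℕ) : Prop where
  proper : N.IsProper
  partition : N.IsRegionPartition R
  valid : N.IsValidLabeling R d
  label_source : d N.s = N.dInf R
  source_saturated : ∀ v, v ≠ N.s → ¬ N.PosEdge N.s v
  isActive_of_reachSet : 0 < N.dInf R → ∀ k, ∀ x ∈ R k, N.HasExcess x →
    (N.regionNetwork (R k)).ReachSet x (N.target (R k) d (N.dInf R)) → N.IsActive R d x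

theorem IsAdmissible.label_le_of_reachSet {V : Type*} [Fintype V] {K : ℕ} {N : Network V}
    {R : Fin K → Finset V} {d : V → ℕ} (hN : N.IsAdmissible R d) {k : Fin K} {u : V} {i : ℕ}
    (h : (N.regionNetwork (R k)).ReachSet u (N.target (R k) d i)) (hu : u ∈ R k) : d u ≤ i := by
  have hR := hN.partition
  refine h.induction_regionNetwork hN.source_saturated (p := (d · ≤ i))
    (fun v hv => hR.notMem_target hv d i) (fun a ha b hab hbA hbT => ?_) hu
  by_cases hb : b ∈ R k
  · exact (hN.valid.intra a b hab (hR.not_interRegion ha hb)).trans (hbA hb)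
  rcases hbT hb with rfl | ⟨hbB, hbi⟩
  · exact ((hN.valid.intra a _ hab hR.not_interRegion_sink).trans_eq hN.valid.sink).trans i.zero_le
  · exact (hN.valid.inter a b hab (hR.interRegion_of_mem_regionBoundary ha hbB)).trans hbi

end Network

namespace SARD

section RegionRelabel

variable {V : Type*} {M : Network V} {A : Finset V} {T : ℕ → Set V} {D i : ℕ} {d : V → ℕ} {u : V}

theorem regionRelabel_of_notMem (hu : u ∉ A) : regionRelabel M A T D d u = d u :=
  if_neg hu

theorem regionRelabel_of_reachSet (hu : u ∈ A) (h : M.ReachSet u (T D)) :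
    regionRelabel M A T D d u = sInf {j | M.ReachSet u (T j)} :=
  (if_pos hu).trans (if_pos h)

theorem regionRelabel_of_not_reachSet (hu : u ∈ A) (h : ¬ M.ReachSet u (T D)) :
    regionRelabel M A T D d u = D :=
  (if_pos hu).trans (if_neg h)

theorem regionRelabel_le (hu : u ∈ A) : regionRelabel M A T D d u ≤ D := by
  by_cases h : M.ReachSet u (T D)
  · exact (regionRelabel_of_reachSet hu h).trans_le (Nat.sInf_le h)
  · exact (regionRelabel_of_not_reachSet hu h).le

theorem reachSet_of_regionRelabel_lt (hu : u ∈ A) (h : regionRelabel M A T D d u < D) :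
    M.ReachSet u (T (regionRelabel M A T D d u)) := by
  have hD : M.ReachSet u (T D) := by
    by_contra hD
    exact h.ne (regionRelabel_of_not_reachSet hu hD)
  rw [regionRelabel_of_reachSet hu hD]
  exact Nat.sInf_mem (s := {j | M.ReachSet u (T j)}) ⟨D, hD⟩

theorem regionRelabel_le_of_reachSet (hT : Monotone T) (hu : u ∈ A) (h : M.ReachSet u (T i)) :
    regionRelabel M A T D d u ≤ i := by
  rcases le_total D i with hi | hi
  · exact (regionRelabel_le hu).trans hi
  · exact (regionRelabel_of_reachSet hu (h.mono (hT hi))).trans_le (Nat.sInf_le h)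

theorem lt_regionRelabel (hT : Monotone T) (hu : u ∈ A) (hi : i < D) (h : ¬ M.ReachSet u (T i)) :
    i < regionRelabel M A T D d u := by
  by_contra! hle
  exact h ((reachSet_of_regionRelabel_lt hu (hle.trans_lt hi)).mono (hT hle))

theorem le_regionRelabel (hT : Monotone T) (hu : u ∈ A) (hi : i ≤ D) (h : ¬ M.ReachSet u (T i)) :
    i ≤ regionRelabel M A T D d u := by
  by_contra! hlt
  exact h ((reachSet_of_regionRelabel_lt hu (hlt.trans_le hi)).mono (hT hlt.le))

end RegionRelabel

end SARD

namespace Network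

variable {V : Type*} [Fintype V] {K : ℕ} {N : Network V} {R : Fin K → Finset V} {d d' : V → ℕ}

/-- What is known of the flow `g` and the labeling `d'` which `ARD` produces on the region `R k` of
the network `N` with the labeling `d`: the flow has gone through all stages, the last of which is
exhausted, and region-relabel has been run. -/
structure IsDischarge (N : Network V) (R : Fin K → Finset V) (d : V → ℕ) (k : Fin K)
    (g : V → V → ℤ) (d' : V → ℕ) : Prop where
  flow : (N.regionNetwork (R k)).IsStageFlow (R k) (N.target (R k) d) (N.dInf R) g
  not_reachSet : ∀ v ∈ R k, ((N.regionNetwork (R k)).residual g).HasExcess v →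
    ¬ ((N.regionNetwork (R k)).residual g).ReachSet v (N.target (R k) d (N.dInf R))
  relabel : d' = SARD.regionRelabel ((N.regionNetwork (R k)).residual g) (R k)
    (N.target (R k) d) (N.dInf R) d

namespace IsDischarge

variable {k : Fin K} {g : V → V → ℤ} {u v : V}

theorem label_of_notMem (h : N.IsDischarge R d k g d') (hu : u ∉ R k) : d' u = d u :=
  h.relabel ▸ SARD.regionRelabel_of_notMem hu

theorem label_le_of_reachSet (h : N.IsDischarge R d k g d') (hu : u ∈ R k) {i : ℕ}
    (hreach : ((N.regionNetwork (R k)).residual g).ReachSet u (N.target (R k) d i)) : d' u ≤ i :=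
  h.relabel ▸ SARD.regionRelabel_le_of_reachSet monotone_target hu hreach

theorem label_le_dInf (h : N.IsDischarge R d k g d') (hN : N.IsAdmissible R d) (u : V) :
    d' u ≤ N.dInf R := by
  by_cases hu : u ∈ R k
  · exact h.relabel ▸ SARD.regionRelabel_le hu
  · exact (h.label_of_notMem hu).trans_le (hN.valid.le_dInf u)

theorem label_source (h : N.IsDischarge R d k g d') (hN : N.IsAdmissible R d) :
    d' N.s = N.dInf R :=
  (h.label_of_notMem (hN.partition.source_notMem k)).trans hN.label_source

theorem le_label (h : N.IsDischarge R d k g d') (hN : N.IsAdmissible R d) (u : V) :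
    d u ≤ d' u := by
  by_cases hu : u ∈ R k
  · have hlabel := h.relabel
    by_contra! hlt
    have hD : d' u < N.dInf R := hlt.trans_le (hN.valid.le_dInf u)
    subst hlabel
    have hreach := SARD.reachSet_of_regionRelabel_lt hu hD
    exact hlt.not_ge (hN.label_le_of_reachSet (h.flow.reachSet_of_residual _ u hreach) hu)
  · exact (h.label_of_notMem hu).ge

theorem isPreflow (h : N.IsDischarge R d k g d') (hN : N.IsAdmissible R d) : N.IsPreflow g :=
  h.flow.isPreflow.of_regionNetwork hN.proper

theorem flow_to_source_eq_zero (h : N.IsDischarge R d k g d') (hN : N.IsAdmissible R d) (v : V) :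
    g v N.s = 0 := by
  have hg := h.isPreflow hN
  have hnonneg (u : V) : 0 ≤ g u N.s := by
    rw [hg.antisymm, neg_nonneg]
    by_cases hu : u = N.s
    · have := hg.antisymm N.s N.s
      rw [hu]
      linarith
    refine (hg.le_capacity hN.proper _ u).trans ?_
    exact not_lt.1 fun hpos => hN.source_saturated u hu (hN.proper.posEdge_of_pos hpos)
  have hsum : ∑ u, g u N.s ≤ 0 := by
    by_contra! hpos
    exact source_notMem_target hN.proper _
      (h.flow.exists_sender N.s (hN.partition.source_notMem k) hpos).1
  exact le_antisymm ((Finset.single_le_sum (f := (g · N.s)) (fun u _ => hnonneg u)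
    (Finset.mem_univ v)).trans hsum) (hnonneg v)

theorem source_saturated (h : N.IsDischarge R d k g d') (hN : N.IsAdmissible R d)
    (hv : v ≠ N.s) : ¬ (N.residual g).PosEdge N.s v := fun hsv =>
  ((h.isPreflow hN).posEdge_or hsv).elim (hN.source_saturated v hv) fun hpos =>
    hpos.ne' (h.flow_to_source_eq_zero hN v)

/- No flow returns from `u` towards a vertex which could still reach a target with label below
`d u`: otherwise `u` would reach it too. -/
theorem posEdge_or_label_le (h : N.IsDischarge R d k g d') (hN : N.IsAdmissible R d)
    (hu : u ∉ R k) (hut : u ≠ N.t) (huv : (N.residual g).PosEdge u v) :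
    N.PosEdge u v ∨ v ∈ R k ∧ d u ≤ d' v := by
  refine ((h.isPreflow hN).posEdge_or huv).imp_right fun hpos => ?_
  have hM := h.flow.isPreflow
  have hedge := hM.posEdge_residual_of_pos (hN.proper.regionNetwork _) hpos
  have hu_not : ¬ ((N.regionNetwork (R k)).residual g).ReachSet u (N.target (R k) d (d u)) :=
    fun hreach => notMem_target_self hut
      (mem_target_of_reachSet hN.source_saturated (h.flow.reachSet_of_residual _ u hreach) hu)
  have hv_not : ¬ ((N.regionNetwork (R k)).residual g).ReachSet v (N.target (R k) d (d u)) :=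
    fun hreach => hu_not (hedge.trans_reachSet hreach)
  have hv : v ∈ R k := by
    rcases hedge.1.2 with ⟨-, hv' | rfl | rfl⟩ | ⟨hu', -⟩ | ⟨-, hv'⟩
    · exact hv'
    · have hgu := h.flow_to_source_eq_zero hN u
      rw [hM.antisymm] at hpos
      exact absurd hpos (by rw [hgu]; decide)
    · exact absurd (.of_mem (sink_mem_target _)) hv_not
    · exact absurd hu' hu
    · exact hv'
  exact ⟨hv, h.relabel ▸ SARD.le_regionRelabel monotone_target hv (hN.valid.le_dInf u) hv_not⟩

theorem label_le_of_posEdge (h : N.IsDischarge R d k g d') (hN : N.IsAdmissible R d)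
    (hu : u ∈ R k) (hv : v ∈ R k) (huv : (N.residual g).PosEdge u v) : d' u ≤ d' v := by
  rcases (h.label_le_dInf hN v).lt_or_eq with hlt | heq
  · have hlabel := h.relabel
    refine h.label_le_of_reachSet hu ?_
    subst hlabel
    exact ((residual_regionNetwork_posEdge_iff_of_mem hu).2 huv).trans_reachSet
      (SARD.reachSet_of_regionRelabel_lt hv hlt)
  · exact heq ▸ h.label_le_dInf hN u

theorem label_eq_zero_of_posEdge_sink (h : N.IsDischarge R d k g d') (hu : u ∈ R k)
    (hut : (N.residual g).PosEdge u N.t) : d' u = 0 :=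
  Nat.le_zero.1 <| h.label_le_of_reachSet hu <|
    ((residual_regionNetwork_posEdge_iff_of_mem hu).2 hut).trans_reachSet
      (.of_mem (sink_mem_target 0))

theorem label_le_succ_of_posEdge (h : N.IsDischarge R d k g d')
    (hu : u ∈ R k) (hv : v ∈ N.regionBoundary (R k)) (huv : (N.residual g).PosEdge u v) :
    d' u ≤ d' v + 1 := by
  refine h.label_le_of_reachSet hu ?_
  rw [h.label_of_notMem hv.1]
  exact ((residual_regionNetwork_posEdge_iff_of_mem hu).2 huv).trans_reachSet
    (.of_mem (.inr ⟨hv, Nat.lt_succ_self _⟩))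

theorem isValidLabeling (h : N.IsDischarge R d k g d') (hN : N.IsAdmissible R d) :
    (N.residual g).IsValidLabeling R d' where
  le_dInf := h.label_le_dInf hN
  sink := (h.label_of_notMem fun ht => hN.partition.ne_sink ht rfl).trans hN.valid.sink
  inter u v huv hinter := by
    by_cases hu : u ∈ R k
    · exact h.label_le_succ_of_posEdge hu
        (hN.partition.mem_regionBoundary_of_interRegion hinter hu huv.1) huv
    · have ⟨_, _, _, hui, _⟩ := hinter
      rw [h.label_of_notMem hu]
      rcases h.posEdge_or_label_le hN hu (hN.partition.ne_sink hui) huv with hold | ⟨-, hle⟩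
      · exact (hN.valid.inter u v hold hinter).trans (Nat.succ_le_succ (h.le_label hN v))
      · exact hle.trans (Nat.le_succ _)
  intra u v huv hintra := by
    by_cases hu : u ∈ R k
    · rcases eq_or_ne v N.s with rfl | hvs
      · exact (h.label_le_dInf hN u).trans_eq (h.label_source hN).symm
      rcases eq_or_ne v N.t with rfl | hvt
      · exact (h.label_eq_zero_of_posEdge_sink hu huv).trans_le (Nat.zero_le _)
      obtain ⟨l, hv⟩ := (hN.partition.cover v).2 ⟨hvs, hvt⟩
      have hkl : k = l := by
        by_contra hkl
        exact hintra ⟨k, l, hkl, hu, hv⟩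
      exact h.label_le_of_posEdge hN hu (hkl ▸ hv) huv
    · rw [h.label_of_notMem hu]
      by_cases hut : u = N.t
      · exact (hut ▸ hN.valid.sink).trans_le (Nat.zero_le _)
      rcases h.posEdge_or_label_le hN hu hut huv with hold | ⟨-, hle⟩
      · exact (hN.valid.intra u v hold hintra).trans (h.le_label hN v)
      · exact hle

theorem not_reachSet_target_residual (h : N.IsDischarge R d k g d') (hN : N.IsAdmissible R d)
    (hv : v ∈ R k) (he : (N.residual g).HasExcess v) :
    ¬ ((N.residual g).regionNetwork (R k)).ReachSet v
      ((N.residual g).target (R k) d' (N.dInf R)) := by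
  intro hreach
  refine h.not_reachSet v hv ((residual_regionNetwork_hasExcess_iff hv).2 he) ?_
  refine hreach.induction_regionNetwork (fun w hw => h.source_saturated hN hw)
    (fun w hw => hN.partition.notMem_target hw d' _)
    (p := (((N.regionNetwork (R k)).residual g).ReachSet · (N.target (R k) d (N.dInf R))))
    (fun a ha b hab hbA hbT => ?_) hv
  refine ((residual_regionNetwork_posEdge_iff_of_mem ha).2 hab).trans_reachSet ?_
  by_cases hb : b ∈ R k
  · exact hbA hb
  · exact .of_mem ((hbT hb).imp_right fun hb' => ⟨hb'.1, h.label_of_notMem hb ▸ hb'.2⟩)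

theorem exists_isActive_sender (h : N.IsDischarge R d k g d') (hN : N.IsAdmissible R d)
    (hv : v ∉ R k) (hvt : v ≠ N.t) (hvD : d v < N.dInf R) (hinflow : 0 < ∑ u, g u v) :
    v ∈ N.regionBoundary (R k) ∧ ∃ x ∈ R k, N.IsActive R d x ∧ d v < d' x := by
  obtain ⟨hvT, x, hx, hxe, hxreach, hxnot⟩ := h.flow.exists_sender v hv hinflow
  exact ⟨(hvT.resolve_left hvt).1, x, hx,
    hN.isActive_of_reachSet hvD.pos k x hx ((regionNetwork_hasExcess_iff hx).1 hxe) hxreach,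
    h.relabel ▸ SARD.lt_regionRelabel monotone_target hx hvD (hxnot _ (notMem_target_self hvt))⟩

/- The induction runs over the vertices of label `d^∞`: an edge which the flow has opened leads
from such a vertex to one whose new label is `d^∞`, hence not to a target. -/
theorem reachSet_target_of_residual (h : N.IsDischarge R d k g d') (hN : N.IsAdmissible R d)
    {l : Fin K} (hlk : l ≠ k) (hv : v ∈ R l) (hvD : d v = N.dInf R)
    (hreach : ((N.residual g).regionNetwork (R l)).ReachSet v
      ((N.residual g).target (R l) d' (N.dInf R))) :
    (N.regionNetwork (R l)).ReachSet v (N.target (R l) d (N.dInf R)) := by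
  have hR := hN.partition
  have hnot {u : V} (hu : u ∈ R l) : u ∉ R k := fun huk => hlk (hR.eq_of_mem hu huk)
  refine hreach.induction_regionNetwork (fun w hw => h.source_saturated hN hw)
    (fun w hw => hR.notMem_target hw d' _) (p := fun u => d u = N.dInf R →
      (N.regionNetwork (R l)).ReachSet u (N.target (R l) d (N.dInf R)))
    (fun a ha b hab hbA hbT haD => ?_) hv hvD
  rcases h.posEdge_or_label_le hN (hnot ha) (hR.ne_sink ha) hab with hold | ⟨hbk, hle⟩
  · refine ((regionNetwork_posEdge_iff_of_mem ha).2 hold).trans_reachSet ?_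
    by_cases hb : b ∈ R l
    · have hab_le := hN.valid.intra a b hold (hR.not_interRegion ha hb)
      exact hbA hb (le_antisymm (hN.valid.le_dInf b) (haD ▸ hab_le))
    · exact .of_mem ((hbT hb).imp_right fun hb' => ⟨hb'.1, (h.le_label hN b).trans_lt hb'.2⟩)
  · rcases hbT fun hbl => hlk (hR.eq_of_mem hbl hbk) with hbt | ⟨-, hlt⟩
    · exact absurd hbt (hR.ne_sink hbk)
    · exact absurd hlt (haD ▸ hle).not_gt

theorem isAdmissible (h : N.IsDischarge R d k g d') (hN : N.IsAdmissible R d) :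
    (N.residual g).IsAdmissible R d' where
  proper := hN.proper.residual (h.isPreflow hN)
  partition := ⟨hN.partition.disjoint, hN.partition.cover⟩
  valid := h.isValidLabeling hN
  label_source := h.label_source hN
  source_saturated _ := h.source_saturated hN
  isActive_of_reachSet hD l x hx he hreach := by
    rcases eq_or_ne l k with rfl | hlk
    · exact absurd hreach (h.not_reachSet_target_residual hN hx he)
    have hxk : x ∉ R k := fun hxk => hlk (hN.partition.eq_of_mem hx hxk)
    refine ⟨he, show d' x < N.dInf R from ?_⟩
    rw [h.label_of_notMem hxk]
    by_contra! hDx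
    have hxD := le_antisymm (hN.valid.le_dInf x) hDx
    rcases he.of_residual_or with hNx | hinflow
    · exact hxD.not_lt (hN.isActive_of_reachSet hD l x hx hNx
        (h.reachSet_target_of_residual hN hlk hx hxD hreach)).2
    · exact hxD.not_lt ((h.flow.exists_sender x hxk hinflow).1.resolve_left
        (hN.partition.ne_sink hx)).2

theorem not_isActive (h : N.IsDischarge R d k g d') (hv : v ∈ R k) :
    ¬ (N.residual g).IsActive R d' v := by
  rintro ⟨he, hlt : d' v < N.dInf R⟩
  have hlabel := h.relabel
  subst hlabel
  exact h.not_reachSet v hv ((residual_regionNetwork_hasExcess_iff hv).2 he)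
    ((SARD.reachSet_of_regionRelabel_lt hv hlt).mono (monotone_target hlt.le))

theorem isActive_or_exists_sender (h : N.IsDischarge R d k g d') (hN : N.IsAdmissible R d)
    (hv : (N.residual g).IsActive R d' v) :
    N.IsActive R d v ∨
      v ∈ N.regionBoundary (R k) ∧ ∃ x ∈ R k, N.IsActive R d x ∧ d v < d' x := by
  have hvk : v ∉ R k := fun hvk => h.not_isActive hvk hv
  have hvD : d v < N.dInf R := h.label_of_notMem hvk ▸ hv.2
  exact hv.1.of_residual_or.imp (fun he => ⟨he, hvD⟩) (h.exists_isActive_sender hN hvk hv.1.1 hvD)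

end IsDischarge

end Network

namespace SARD

section Gap

variable {V : Type*} [Fintype V] {K : ℕ} {N : Network V} {R : Fin K → Finset V} {d d' : V → ℕ}

namespace GapStep

theorem le_label (h : GapStep N R d d') (hd : ∀ v, d v ≤ N.dInf R) (v : V) : d v ≤ d' v := by
  obtain ⟨g, -, -, rfl⟩ := h
  have := hd v
  dsimp only
  split_ifs <;> omega

theorem label_eq_of_lt (h : GapStep N R d d') {v : V} (hv : d' v < N.dInf R) : d' v = d v := by
  obtain ⟨g, -, -, rfl⟩ := h
  exact (ite_eq_or_eq _ _ _).resolve_left hv.ne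

theorem isActive (h : GapStep N R d d') {v : V} (hv : N.IsActive R d' v) : N.IsActive R d v :=
  ⟨hv.1, h.label_eq_of_lt hv.2 ▸ hv.2⟩

theorem isValidLabeling (h : GapStep N R d d') (hR : N.IsRegionPartition R)
    (hd : N.IsValidLabeling R d) : N.IsValidLabeling R d' := by
  obtain ⟨g, -, hgap, rfl⟩ := h
  have hle := hd.le_dInf
  constructor
  case le_dInf =>
    intro v
    have := hle v
    split_ifs <;> omega
  case sink => simp [hd.sink]
  case inter =>
    intro u v huv hinter
    have := hd.inter u v huv hinter
    have := hgap v (hinter.mem_boundary hR huv.1)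
    have := hle v
    split_ifs <;> omega
  case intra =>
    intro u v huv hintra
    have := hd.intra u v huv hintra
    have := hle v
    split_ifs <;> omega

theorem isAdmissible (h : GapStep N R d d') (hN : N.IsAdmissible R d) : N.IsAdmissible R d' where
  proper := hN.proper
  partition := hN.partition
  valid := h.isValidLabeling hN.partition hN.valid
  label_source := by
    obtain ⟨g, -, -, rfl⟩ := h
    simp [hN.label_source]
  source_saturated := hN.source_saturated
  isActive_of_reachSet hD k x hx he hreach := by
    obtain ⟨g, -, hgap, rfl⟩ := h
    refine ⟨he, ?_⟩
    have hlabel {y : V} (hy : y ∈ N.regionBoundary (R k))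
        (hlt : (if g < d y then N.dInf R else d y) < N.dInf R) : d y < g ∧ d y < N.dInf R := by
      have := hgap y (Network.mem_boundary.2 ⟨k, hy⟩)
      split_ifs at hlt <;> omega
    have hx_le : d x ≤ g := hN.label_le_of_reachSet
      (hreach.mono fun y hy => hy.imp_right fun hyB => ⟨hyB.1, (hlabel hyB.1 hyB.2).1⟩) hx
    have hx_active := hN.isActive_of_reachSet hD k x hx he
      (hreach.mono fun y hy => hy.imp_right fun hyB => ⟨hyB.1, (hlabel hyB.1 hyB.2).2⟩)
    exact (if_neg hx_le.not_gt).trans_lt hx_active.2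

end GapStep

end Gap

section Potential

open Network

variable {V : Type*} [Fintype V] {K : ℕ} {N : Network V} {R : Fin K → Finset V} {d d' : V → ℕ}
  {m m' : Fin K → ℕ} {k : Fin K} {n : ℕ}

/-- The potential argument behind the bound on the number of sweeps: when the region `R i` has been
discharged `m i` times, an active vertex of `R i` lies on the boundary (if `m i > 0`), and its
label leaves the label sum of the boundary room for the `m i` discharges. -/
def PotentialBound (N : Network V) (R : Fin K → Finset V) (d : V → ℕ) (m : Fin K → ℕ) : Prop :=
  ∀ i, ∀ v ∈ R i, N.IsActive R d v →
    (0 < m i → v ∈ N.boundary R) ∧ d v + m i ≤ ∑ u ∈ N.boundary R, d u + N.dInf R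

/-- How often the region `R i` has been discharged when, in the sweep number `n ≥ 1`, the regions
of index below `k` have been processed. -/
def dischargeCount (k n : ℕ) (i : Fin K) : ℕ := if (i : ℕ) < k then n else n - 1

theorem dischargeCount_zero_succ (n : ℕ) : (dischargeCount 0 (n + 1) : Fin K → ℕ) = fun _ => n :=
  funext fun _ => if_neg (Nat.not_lt_zero _)

theorem dischargeCount_self (n : ℕ) : (dischargeCount K n : Fin K → ℕ) = fun _ => n :=
  funext fun i => if_pos i.isLt

theorem dischargeCount_succ_of_ne {i : Fin K} (hik : i ≠ k) :
    dischargeCount (k + 1) n i = dischargeCount k n i := by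
  have : (i : ℕ) ≠ k := Fin.val_ne_of_ne hik
  unfold dischargeCount
  split_ifs <;> omega

theorem dischargeCount_le_succ (i : Fin K) : dischargeCount k n i ≤ dischargeCount k n k + 1 := by
  unfold dischargeCount
  split_ifs <;> omega

namespace PotentialBound

theorem zero : PotentialBound N R d 0 := fun _ _ _ hv =>
  ⟨fun h => absurd h (lt_irrefl 0), hv.2.le.trans (Nat.le_add_left _ _)⟩

theorem discharge (h : PotentialBound N R d m) (hN : N.IsAdmissible R d) {g : V → V → ℤ}
    (hg : N.IsDischarge R d k g d') (hm : ∀ i, m i ≤ m k + 1) (hm' : ∀ i, i ≠ k → m' i = m i) :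
    PotentialBound (N.residual g) R d' m' := by
  intro i v hv hactive
  change (0 < m' i → v ∈ N.boundary R) ∧ d' v + m' i ≤ ∑ u ∈ N.boundary R, d' u + N.dInf R
  have hvk : v ∉ R k := fun hvk => hg.not_isActive hvk hactive
  rw [hm' i fun hik => hvk (hik ▸ hv), hg.label_of_notMem hvk]
  rcases hg.isActive_or_exists_sender hN hactive with hold | ⟨hvB, x, hx, hxactive, hvx⟩
  · have hsum := Finset.sum_le_sum fun u (_ : u ∈ N.boundary R) => hg.le_label hN u
    exact (h i v hv hold).imp_right fun hle => hle.trans (add_le_add_left hsum _)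
  · refine ⟨fun _ => mem_boundary.2 ⟨k, hvB⟩, ?_⟩
    have hmi := hm i
    have ⟨hxB, hxle⟩ := h k x hx hxactive
    rcases Nat.eq_zero_or_pos (m k) with hmk | hmk
    · have := hg.label_le_dInf hN x
      omega
    · have := add_sum_le_add_sum_of_le (hxB hmk) fun u _ => hg.le_label hN u
      omega

theorem gap (h : PotentialBound N R d m) (hd : ∀ v, d v ≤ N.dInf R) (hgap : GapStep N R d d') :
    PotentialBound N R d' m := by
  intro i v hv hactive
  rw [hgap.label_eq_of_lt hactive.2]
  have hsum := Finset.sum_le_sum fun u (_ : u ∈ N.boundary R) => hgap.le_label hd u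
  exact (h i v hv (hgap.isActive hactive)).imp_right fun hle => hle.trans (add_le_add_left hsum _)

theorem le_two_mul_sq (h : PotentialBound N R d fun _ => n) (hN : N.IsAdmissible R d) {v : V}
    (hv : N.IsActive R d v) : n ≤ 2 * N.dInf R ^ 2 := by
  have hvs : v ≠ N.s := by
    rintro rfl
    exact hv.2.ne hN.label_source
  obtain ⟨i, hi⟩ := (hN.partition.cover v).2 ⟨hvs, hv.1.1⟩
  have hle : d v + n ≤ ∑ u ∈ N.boundary R, d u + N.dInf R := (h i v hi hv).2
  have hsum : ∑ u ∈ N.boundary R, d u ≤ N.dInf R * N.dInf R :=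
    Finset.sum_le_card_nsmul _ _ _ fun u _ => hN.valid.le_dInf u
  have hsq := Nat.le_mul_self (N.dInf R)
  rw [sq]
  omega

end PotentialBound

end Potential

end SARD

namespace Network

section Cut

variable {V : Type*} [Fintype V] {G : Network V} {f : V → V → ℤ}

open Classical in
theorem IsPreflow.sum_add_inflow_eq (hf : G.IsPreflow f) (S : Finset V) :
    ∑ v ∈ S, (G.e v + ∑ u, f u v) = ∑ v ∈ S, G.e v + ∑ v ∈ S, ∑ u ∈ Sᶜ, f u v := by
  simp only [Finset.sum_add_distrib, ← Finset.sum_add_sum_compl S (f · _),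
    sum_sum_eq_zero_of_antisymm hf.antisymm, zero_add]

open Classical in
theorem IsPreflow.value_le_cut (hf : G.IsPreflow f) (hG : G.IsProper) {S : Finset V}
    (ht : G.t ∈ S) (hs : G.s ∉ S) :
    G.value f ≤ ∑ v ∈ S, G.e v + ∑ v ∈ S, ∑ u ∈ Sᶜ, G.c u v :=
  calc G.value f = G.e G.t + ∑ u, f u G.t := by rw [hG.e_t, zero_add, value]
    _ ≤ ∑ v ∈ S, (G.e v + ∑ u, f u v) := Finset.single_le_sum
      (f := fun v => G.e v + ∑ u, f u v) (fun v hv => hf.preflow v fun hvs => hs (hvs ▸ hv)) ht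
    _ = ∑ v ∈ S, G.e v + ∑ v ∈ S, ∑ u ∈ Sᶜ, f u v := hf.sum_add_inflow_eq S
    _ ≤ ∑ v ∈ S, G.e v + ∑ v ∈ S, ∑ u ∈ Sᶜ, G.c u v := by
      gcongr with v _ u _
      exact hf.le_capacity hG u v

open Classical in
theorem IsPreflow.value_eq_cut (hf : G.IsPreflow f) (hG : G.IsProper) {S : Finset V}
    (ht : G.t ∈ S) (hs : G.s ∉ S) (hexcess : ∀ v ∈ S, ¬ (G.residual f).HasExcess v)
    (hsaturated : ∀ v ∈ S, ∀ u ∉ S, ¬ (G.residual f).PosEdge u v) :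
    G.value f = ∑ v ∈ S, G.e v + ∑ v ∈ S, ∑ u ∈ Sᶜ, G.c u v := by
  have hcap : ∀ v ∈ S, ∀ u ∈ Sᶜ, f u v = G.c u v := fun v hv u hu => by
    refine (hf.le_capacity hG u v).antisymm (not_lt.1 fun hlt => ?_)
    exact hsaturated v hv u (Finset.mem_compl.1 hu)
      ((hG.residual hf).posEdge_of_pos (sub_pos.2 hlt))
  have hzero : ∀ v ∈ S, v ≠ G.t → G.e v + ∑ u, f u v = 0 := fun v hv hvt => by
    refine le_antisymm (not_lt.1 fun hlt => hexcess v hv ⟨hvt, .inr ?_⟩)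
      (hf.preflow v fun hvs => hs (hvs ▸ hv))
    rwa [residual_e_of_ne hvt]
  calc G.value f = G.e G.t + ∑ u, f u G.t := by rw [hG.e_t, zero_add, value]
    _ = ∑ v ∈ S, (G.e v + ∑ u, f u v) := (Finset.sum_eq_single_of_mem G.t ht hzero).symm
    _ = ∑ v ∈ S, G.e v + ∑ v ∈ S, ∑ u ∈ Sᶜ, f u v := hf.sum_add_inflow_eq S
    _ = ∑ v ∈ S, G.e v + ∑ v ∈ S, ∑ u ∈ Sᶜ, G.c u v :=
      congrArg _ <| Finset.sum_congr rfl fun v hv => Finset.sum_congr rfl (hcap v hv)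

open Classical in
theorem IsPreflow.isMaxPreflow (hf : G.IsPreflow f) (hG : G.IsProper)
    (h : ∀ v, (G.residual f).HasExcess v → ¬ (G.residual f).Reach v G.t) : G.IsMaxPreflow f := by
  let S : Finset V := {v | (G.residual f).Reach v G.t}
  have mem_S {v : V} : v ∈ S ↔ (G.residual f).Reach v G.t := by simp [S]
  have ht : G.t ∈ S := mem_S.2 .refl
  have hs : G.s ∉ S := fun hs => h G.s ⟨hG.s_ne_t, .inl rfl⟩ (mem_S.1 hs)
  have hvalue := hf.value_eq_cut hG ht hs (fun v hv he => h v he (mem_S.1 hv))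
    fun v hv u hu huv => hu (mem_S.2 (.head huv (mem_S.1 hv)))
  exact ⟨hf, fun f' hf' => hvalue ▸ hf'.value_le_cut hG ht hs⟩

end Cut

section ValidLabeling

variable {V : Type*} [Fintype V] {K : ℕ} {N : Network V} {R : Fin K → Finset V} {d : V → ℕ} {v : V}

theorem IsValidLabeling.exists_posEdge_of_lt_label (hd : N.IsValidLabeling R d)
    (h : N.Reach v N.t) {i : ℕ} (hi : i < d v) :
    ∃ a b, N.PosEdge a b ∧ InterRegion R a b ∧ d a = i + 1 ∧ d b = i := by
  by_contra! hno
  refine hi.not_ge (ReachSet.induction (Y := {N.t}) (p := (d · ≤ i)) ?_ ?_ ⟨N.t, rfl, h⟩)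
  · rintro y rfl
    exact hd.sink.trans_le i.zero_le
  · intro a b hab _ hb
    by_cases hinter : InterRegion R a b
    · have := hd.inter a b hab hinter
      have := hno a b hab hinter
      omega
    · exact (hd.intra a b hab hinter).trans hb

/- A path to the sink passes through all labels from `d v` down to `0`, and where the label drops
there is a boundary vertex on either side: a label `d^∞ = |𝓑|` would require `|𝓑| + 1` boundary
vertices. -/
theorem IsValidLabeling.label_lt_dInf_of_reach_sink (hd : N.IsValidLabeling R d) (hN : N.IsProper)
    (hR : N.IsRegionPartition R) (hD : 0 < N.dInf R) (h : N.Reach v N.t) : d v < N.dInf R := by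
  by_contra! hv
  have hsubset : Finset.range (N.dInf R + 1) ⊆ (N.boundary R).image d := by
    intro i hi
    rw [Finset.mem_image]
    rcases (Nat.lt_succ_iff.1 (Finset.mem_range.1 hi)).lt_or_eq with hi | rfl
    · obtain ⟨a, b, hab, hinter, -, hb⟩ := hd.exists_posEdge_of_lt_label h (hi.trans_le hv)
      exact ⟨b, hinter.mem_boundary hR hab.1, hb⟩
    · obtain ⟨a, b, hab, hinter, ha, -⟩ :=
        hd.exists_posEdge_of_lt_label h ((Nat.pred_lt hD.ne').trans_le hv)
      exact ⟨a, hinter.symm.mem_boundary hR (hN.symm _ _ hab.1), ha.trans (Nat.succ_pred hD.ne')⟩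
  have hcard := (Finset.card_le_card hsubset).trans Finset.card_image_le
  rw [Finset.card_range] at hcard
  exact hcard.not_gt (Nat.lt_succ_self _)

end ValidLabeling

end Network

namespace SARD

open Network

variable {V : Type*} [Fintype V] {K : ℕ} {G : Network V} {R : Fin K → Finset V}

section Init

theorem isPreflow_initFlow (hG : G.IsProper) : G.IsPreflow (initFlow G) where
  off u v h := by
    have h' : ¬ G.E v u := fun h' => h (hG.symm v u h')
    simp [initFlow, hG.c_off u v h, hG.c_off v u h']
  capacity u v _ := by
    have := hG.capacity_nonneg u v
    have := hG.capacity_nonneg v u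
    unfold initFlow
    split_ifs <;> linarith
  antisymm u v := by
    unfold initFlow
    split_ifs <;> simp_all
  preflow v hv := by
    refine add_nonneg (hG.e_nonneg v hv) (Finset.sum_nonneg fun u _ => ?_)
    have := hG.capacity_nonneg u v
    unfold initFlow
    rw [if_neg hv]
    split_ifs <;> linarith

theorem not_posEdge_residual_initFlow_source {v : V} (hv : v ≠ G.s) :
    ¬ (G.residual (initFlow G)).PosEdge G.s v := by
  have hc : (G.residual (initFlow G)).c G.s v = 0 :=
    sub_eq_zero.2 ((if_neg hv.symm).trans (if_pos rfl)).symm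
  exact fun h => h.2.ne' hc

theorem initState_d_of_ne {v : V} (hv : v ≠ G.s) : (initState G R).d v = 0 :=
  if_neg hv

theorem initState_d_source : (initState G R).d G.s = G.dInf R :=
  if_pos rfl

theorem isAdmissible_initState (hG : G.IsProper) (hR : G.IsRegionPartition R) :
    (G.residual (initState G R).f).IsAdmissible R (initState G R).d where
  proper := hG.residual (isPreflow_initFlow hG)
  partition := ⟨hR.disjoint, hR.cover⟩
  valid :=
    { le_dInf := fun v => by
        rcases eq_or_ne v G.s with rfl | hv
        · exact initState_d_source.le
        · exact (initState_d_of_ne hv).trans_le (Nat.zero_le _)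
      sink := initState_d_of_ne hG.s_ne_t.symm
      inter := fun u v _ ⟨_, _, _, hu, _⟩ =>
        (initState_d_of_ne (hR.ne_source hu)).trans_le (Nat.zero_le _)
      intra := fun u v huv _ => by
        rcases eq_or_ne u G.s with rfl | hu
        · have hv : v = G.s := not_not.1 fun hv => not_posEdge_residual_initFlow_source hv huv
          rw [hv]
        · exact (initState_d_of_ne hu).trans_le (Nat.zero_le _) }
  label_source := initState_d_source
  source_saturated _ hv := not_posEdge_residual_initFlow_source (G := G) hv
  isActive_of_reachSet hD _ _ hx he _ := ⟨he, (initState_d_of_ne (hR.ne_source hx)).trans_lt hD⟩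

end Init

section Invariant

/-- The part of the invariant of the algorithm which depends on the position in the program; `n` is
the number of sweeps begun. -/
def ControlInvariant (N : Network V) (R : Fin K → Finset V) (d : V → ℕ) (n : ℕ) :
    Control V K → Prop
  | .test => PotentialBound N R d fun _ => n
  | .forLoop k => k ≤ K ∧ PotentialBound N R d (dischargeCount k n)
  | .stage k j g => j ≤ N.dInf R ∧ PotentialBound N R d (dischargeCount k n) ∧
      (N.regionNetwork (R k)).IsStageFlow (R k) (N.target (R k) d) j g
  | .halted => ∀ v, ¬ N.IsActive R d v

/-- The invariant of the algorithm: it holds initially and is kept by every elementary step. -/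
structure Invariant (G : Network V) (R : Fin K → Finset V) (σ : State V K) : Prop where
  isPreflow : G.IsPreflow σ.f
  isAdmissible : (G.residual σ.f).IsAdmissible R σ.d
  sweeps_le : σ.sweeps ≤ 2 * G.dInf R ^ 2 + 1
  control : ControlInvariant (G.residual σ.f) R σ.d σ.sweeps σ.control

theorem invariant_initState (hG : G.IsProper) (hR : G.IsRegionPartition R) :
    Invariant G R (initState G R) where
  isPreflow := isPreflow_initFlow hG
  isAdmissible := isAdmissible_initState hG hR
  sweeps_le := Nat.zero_le _
  control := PotentialBound.zero

theorem Invariant.step {σ σ' : State V K} (hσ : Invariant G R σ) (hG : G.IsProper)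
    (hstep : Step G R σ σ') : Invariant G R σ' := by
  obtain ⟨hf, hN, hsweeps, hcontrol⟩ := hσ
  cases hstep with
  | halt f d n h => exact ⟨hf, hN, hsweeps, h⟩
  | sweep f d n v h =>
    have hbound : PotentialBound (G.residual f) R d fun _ => n := hcontrol
    refine ⟨hf, hN, Nat.succ_le_succ (hbound.le_two_mul_sq hN h), Nat.zero_le K, ?_⟩
    rwa [dischargeCount_zero_succ]
  | sweepEnd f d n =>
    have hbound : PotentialBound (G.residual f) R d (dischargeCount K n) := hcontrol.2
    rw [dischargeCount_self] at hbound
    exact ⟨hf, hN, hsweeps, hbound⟩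
  | call f d n k =>
    exact ⟨hf, hN, hsweeps, Nat.zero_le _, hcontrol.2, .zero (hN.proper.regionNetwork _)⟩
  | augment f d n k j g g' h =>
    obtain ⟨hj, hbound, hflow⟩ := hcontrol
    exact ⟨hf, hN, hsweeps, hj, hbound, hflow.augment (hN.proper.regionNetwork _) monotone_target
      (hN.partition.source_notMem k) (fun v hv => hN.partition.notMem_target hv d j) h⟩
  | nextStage f d n k j g hj h =>
    exact ⟨hf, hN, hsweeps, hj, hcontrol.2.1, hcontrol.2.2.succ monotone_target h⟩
  | finish f d n k g d' d'' h hd' hd'' =>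
    obtain ⟨-, hbound, hflow⟩ := hcontrol
    have hg : (G.residual f).IsDischarge R d k g d' :=
      ⟨hflow, fun v => not_reachSet_of_no_augmentStep h, hd'⟩
    have hN' := hg.isAdmissible hN
    have hbound' := hbound.discharge hN hg dischargeCount_le_succ
      fun i hik => dischargeCount_succ_of_ne hik
    have hf' := hf.add hG (hg.isPreflow hN)
    rw [residual_residual] at hN' hbound'
    rcases hd'' with rfl | hgap
    · exact ⟨hf', hN', hsweeps, k.isLt, hbound'⟩
    have hgap : GapStep (G.residual fun u v => f u v + g u v) R d' d'' := hgap
    exact ⟨hf', hgap.isAdmissible hN', hsweeps, k.isLt, hbound'.gap hN'.valid.le_dInf hgap⟩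

theorem Reachable.invariant {σ : State V K} (h : Reachable G R σ) (hG : G.IsProper)
    (hR : G.IsRegionPartition R) : Invariant G R σ := by
  induction h with
  | refl => exact invariant_initState hG hR
  | tail _ hstep ih => exact ih.step hG hstep

theorem Invariant.control_eq_halted {σ : State V K} (hσ : Invariant G R σ)
    (h : ∀ σ', ¬ Step G R σ σ') : σ.control = .halted := by
  obtain ⟨f, d, n, control⟩ := σ
  cases control with
  | halted => rfl
  | test =>
    by_cases hactive : ∃ v, (G.residual f).IsActive R d v
    · obtain ⟨v, hv⟩ := hactive
      exact absurd (.sweep f d n v hv) (h _)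
    · exact absurd (.halt f d n (not_exists.1 hactive)) (h _)
  | forLoop k =>
    rcases hσ.control.1.lt_or_eq with hk | rfl
    · exact absurd (.call f d n ⟨k, hk⟩) (h _)
    · exact absurd (.sweepEnd f d n) (h _)
  | stage k j g =>
    by_cases haug : ∃ g', (currentRegion G R f k).AugmentStep (R k) (G.target (R k) d j) g g'
    · obtain ⟨g', hg'⟩ := haug
      exact absurd (.augment f d n k j g g' hg') (h _)
    · have hj : j ≤ G.dInf R := hσ.control.1
      rcases hj.lt_or_eq with hj | rfl
      · exact absurd (.nextStage f d n k j g hj (not_exists.1 haug)) (h _)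
      · exact absurd (.finish f d n k g _ _ (not_exists.1 haug) rfl (.inl rfl)) (h _)

end Invariant

section Termination

/-- What remains to be done in the current sweep: the remaining control points between discharges,
then the remaining stages, and last the excess left in the region, which every augmentation
decreases. -/
noncomputable def remainingWork (G : Network V) (R : Fin K → Finset V) (f : V → V → ℤ) :
    Control V K → ℕ ×ₗ ℕ ×ₗ ℕ
  | .test => toLex (1, toLex (0, 0))
  | .forLoop k => toLex (2 * (K - k) + 2, toLex (0, 0))
  | .stage k j g => toLex (2 * (K - k) + 1, toLex (G.dInf R - j,
      (∑ v ∈ R k, ((currentRegion G R f k).residual g).e v).toNat))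
  | .halted => toLex (0, toLex (0, 0))

/-- The termination measure of the algorithm: the number of sweeps left, then the remaining work in
the current sweep. -/
noncomputable def stateMeasure (G : Network V) (R : Fin K → Finset V) (σ : State V K) :
    ℕ ×ₗ ℕ ×ₗ ℕ ×ₗ ℕ :=
  toLex (2 * G.dInf R ^ 2 + 1 - σ.sweeps, remainingWork G R σ.f σ.control)

theorem Invariant.stateMeasure_lt {σ σ' : State V K} (hσ : Invariant G R σ) (hG : G.IsProper)
    (hstep : Step G R σ σ') : stateMeasure G R σ' < stateMeasure G R σ := by
  have hσ' := hσ.step hG hstep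
  cases hstep with
  | halt f d n h => exact .right _ (.left _ _ Nat.zero_lt_one)
  | sweep f d n v h =>
    have hn : n + 1 ≤ 2 * G.dInf R ^ 2 + 1 := hσ'.sweeps_le
    exact .left _ _ (Nat.sub_lt_sub_left hn n.lt_succ_self)
  | sweepEnd f d n => exact .right _ (.left _ _ (by omega))
  | call f d n k => exact .right _ (.left _ _ (Nat.lt_succ_self _))
  | augment f d n k j g g' h =>
    obtain ⟨-, -, hflow⟩ := hσ.control
    obtain ⟨-, -, hflow'⟩ := hσ'.control
    have hN := hσ.isAdmissible
    have hs : G.s ∉ R k := hN.partition.source_notMem k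
    have hM : (currentRegion G R f k).IsProper := hN.proper.regionNetwork _
    have hlt := h.sum_excess_lt hM hflow.isPreflow hs
      fun v hv => hN.partition.notMem_target hv d j
    have hnonneg := Finset.sum_nonneg fun v (hv : v ∈ R k) =>
      (hM.residual hflow'.isPreflow).e_nonneg v fun hvs => hs (hvs ▸ hv)
    exact .right _ (.right _ (.right _ ((Int.toNat_lt_toNat (hnonneg.trans_lt hlt)).2 hlt)))
  | nextStage f d n k j g hj h =>
    exact .right _ (.right _ (.left _ _ (Nat.sub_lt_sub_left hj j.lt_succ_self)))
  | finish f d n k g d' d'' h hd' hd'' =>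
    have := k.isLt
    exact .right _ (.left _ _ (by omega))

theorem not_forall_step (hG : G.IsProper) (hR : G.IsRegionPartition R) {σ : ℕ → State V K}
    (h0 : σ 0 = initState G R) : ¬ ∀ n, Step G R (σ n) (σ (n + 1)) := by
  intro hstep
  have hreach (n : ℕ) : Reachable G R (σ n) := by
    induction n with
    | zero => exact h0 ▸ .refl
    | succ n ih => exact .tail ih (hstep n)
  obtain ⟨n, hn⟩ := WellFounded.not_rel_apply_succ (r := (· < ·)) fun n => stateMeasure G R (σ n)
  exact hn (((hreach n).invariant hG hR).stateMeasure_lt hG (hstep n))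

end Termination

end SARD

theorem mainTheorem1 {V : Type*} [Fintype V] (G : Network V) (hG : G.IsProper)
    {K : ℕ} (R : Fin K → Finset V) (hR : G.IsRegionPartition R) :
    -- every execution is finite
    (¬ ∃ σ : ℕ → SARD.State V K, σ 0 = SARD.initState G R ∧
      ∀ n, SARD.Step G R (σ n) (σ (n + 1))) ∧
    -- and makes at most `2|𝓑|² + 1` sweeps
    (∀ σ, SARD.Reachable G R σ → σ.sweeps ≤ 2 * (G.boundary R).card ^ 2 + 1) ∧
    -- a state from which the execution cannot continue is a correct final state
    (∀ σ, SARD.Reachable G R σ → (∀ σ', ¬ SARD.Step G R σ σ') →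
      σ.control = .halted ∧
      G.IsPreflow σ.f ∧
      (G.residual σ.f).IsValidLabeling R σ.d ∧
      (∀ v, ¬ (G.residual σ.f).IsActive R σ.d v) ∧
      ((G.boundary R).Nonempty → G.IsMaxPreflow σ.f)) := by
  refine ⟨fun ⟨σ, h0, hstep⟩ => SARD.not_forall_step hG hR h0 hstep,
    fun σ hσ => (hσ.invariant hG hR).sweeps_le, fun σ hσ hfinal => ?_⟩
  have hinv := hσ.invariant hG hR
  have hhalted := hinv.control_eq_halted hfinal
  have hactive : ∀ v, ¬ (G.residual σ.f).IsActive R σ.d v := by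
    have hcontrol := hinv.control
    rwa [hhalted] at hcontrol
  obtain ⟨hf, hN, -, -⟩ := hinv
  refine ⟨hhalted, hf, hN.valid, hactive, fun hB => hf.isMaxPreflow hG fun v hv hreach => ?_⟩
  exact hactive v
    ⟨hv, hN.valid.label_lt_dInf_of_reach_sink hN.proper hN.partition hB.card_pos hreach⟩
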